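/- Let $d\ge 1$, $n\ge 2$, $T\ge 0$ be integers and let $\Theta\subset\mathbb{R}^d$ be a bounded measurable set with Lebesgue measure $|\Theta|$. Let $g$ be a (measurable) map from $\Theta$ to Markov decision processes with common state space $S$ and action space $A$: the MDP $g(\theta)$ has an initial state distribution $P_{\mathrm{init}}$, a transition law $P(\cdot\mid s,a)$, a random cost with law $C(\cdot\mid s,a)$ supported in $[0,C_{\max}]$, and an episode length $H\ge 1$; every $H$ steps the state is drawn anew from $P_{\mathrm{init}}$. A policy $\pi$ chooses (possibly at random) the action $a_t$ from the whole history $(s_0,a_0,c_0,\dots,s_{t-1},a_{t-1},c_{t-1},s_t)$, and $L_{M,\pi}=\mathbb{E}_{\pi,M}\big[\sum_{t=0}^{T-1}c_t\big]$ is its expected cumulative cost in the MDP $M$. For a density $p$ put $$\mathcal{L}_p(\pi)=\int_\Theta L_{g(\theta),\pi}\,p(\theta)\,d\theta .$$ Let the prior $f:\mathbb{R}^d\to[0,\infty)$ be a probability density concentrated on $\Theta$ which is bounded and $\alpha$-Hölder: $|f(x)-f(y)|\le C_\alpha\|x-y\|^\alpha$ for all $x,y\in\mathbb{R}^d$, where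 $0<\alpha\le 1$, $C_\alpha>0$ and $\|\cdot\|$ is the Euclidean norm. The regret of a policy is $\mathcal{R}_T(\pi)=\mathcal{L}_f(\pi)-\inf_{\pi'}\mathcal{L}_f(\pi')$, i.e. the excess of $\mathcal{L}_f(\pi)$ over the value of a Bayes-optimal policy. Let $X_1,\dots,X_n$ be independent samples from $f$ and let $$\widehat f_G(x)=\frac{1}{n\,(h\sqrt{2\pi})^{d}}\sum_{i=1}^n e^{-\|x-X_i\|^2/(2h^2)},\qquad h=\Big(\frac{\log n}{n}\Big)^{\frac{1}{2\alpha+d}},$$ be the Gaussian kernel density estimate. Then, with probability at least $1-1/n$, every policy $\widehat\pi\in\arg\min_\pi\mathcal{L}_{\widehat f_G}(\pi)$ satisfies $$\mathcal{R}_T(\widehat\pi)\le 2\,C_{\max}\,T\,|\Theta|\,C_d\Big(\frac{\log n}{n}\Big)^{\frac{\alpha}{2\alpha+d}},$$ where $$C_d=C_\alpha 2^{\frac{\alpha-1}{2}}+\frac{16\,d\,\sqrt{C_\alpha\,\Delta_{\max}(\Theta)^{\alpha}+1/|\Theta|}}{\sqrt2\,(2\pi)^{d/4}}+\frac{64\,d^2}{(2\pi)^{d/2}}$$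 and $\Delta_{\max}(\Theta)$ is the largest (supremal) $\ell_1$ distance between two points of $\Theta$. -/

import Mathlib

open MeasureTheory ProbabilityTheory

/-- A Markov decision process with state space `S`, action space `A` and real-valued costs:
initial state distribution, random cost `C(· ∣ s, a)`, transition law `P(· ∣ s, a)` and
episode length (horizon) `H ≥ 1`. -/
structure MDP (S A : Type*) [MeasurableSpace S] [MeasurableSpace A] where
  init : Measure S
  cost : Kernel (S × A) ℝ
  trans : Kernel (S × A) S
  horizon : ℕ
  isProbabilityMeasure_init : IsProbabilityMeasure init
  isMarkovKernel_cost : IsMarkovKernel cost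
  isMarkovKernel_trans : IsMarkovKernel trans
  horizon_pos : 0 < horizon

attribute [instance] MDP.isProbabilityMeasure_init MDP.isMarkovKernel_cost
  MDP.isMarkovKernel_trans

/-- Histories `h_t = (s₀, a₀, c₀, …, s_{t-1}, a_{t-1}, c_{t-1}, s_t)`. -/
abbrev History (S A : Type*) (t : ℕ) : Type _ := (Fin t → S × A × ℝ) × S

/-- A (randomized) history-dependent policy: a law on actions for every history. -/
structure Policy (S A : Type*) [MeasurableSpace S] [MeasurableSpace A] where
  act : (t : ℕ) → Kernel (History S A t) A
  isMarkovKernel_act : ∀ t, IsMarkovKernel (act t)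

attribute [instance] Policy.isMarkovKernel_act

namespace MDP

variable {S A : Type*} [MeasurableSpace S] [MeasurableSpace A]

open Classical in
/-- The law of `s_{t+1}` given `(s_t, a_t)`: the state is resampled from the initial distribution
every `H` steps and moves by the transition law otherwise. -/
noncomputable def nextState (M : MDP S A) (t : ℕ) : Kernel (S × A) S :=
  if M.horizon ∣ t + 1 then Kernel.const (S × A) M.init else M.trans

instance isMarkovKernel_nextState (M : MDP S A) (t : ℕ) : IsMarkovKernel (M.nextState t) := by
  unfold nextState
  split_ifs <;> infer_instance

/-- The law of `(a_t, c_t, s_{t+1})` given the history `h_t`; the cost and the next state are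
conditionally independent given `(s_t, a_t)`. -/
noncomputable def stepKernel (M : MDP S A) (π : Policy S A) (t : ℕ) :
    Kernel (History S A t) (A × ℝ × S) :=
  π.act t ⊗ₖ
    (M.cost ×ₖ M.nextState t).comap (fun p : History S A t × A => (p.1.2, p.2)) (by fun_prop)

instance isMarkovKernel_stepKernel (M : MDP S A) (π : Policy S A) (t : ℕ) :
    IsMarkovKernel (M.stepKernel π t) := by
  unfold stepKernel
  infer_instance

/-- Appending `(a_t, c_t, s_{t+1})` to the history `h_t`. -/
def extendHistory (t : ℕ) (p : History S A t × A × ℝ × S) : History S A (t + 1) :=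
  (Fin.snoc (α := fun _ => S × A × ℝ) p.1.1 (p.1.2, p.2.1, p.2.2.1), p.2.2.2)

theorem measurable_extendHistory (t : ℕ) :
    Measurable (extendHistory (S := S) (A := A) t) := by
  refine Measurable.prodMk ?_ (by fun_prop)
  refine measurable_pi_iff.2 fun i => ?_
  refine Fin.lastCases ?_ (fun j => ?_) i
  · simp only [Fin.snoc_last]
    fun_prop
  · simp only [Fin.snoc_castSucc]
    fun_prop

/-- The law of the history `h_t` when the policy `π` acts in the MDP `M`. -/
noncomputable def historyLaw (M : MDP S A) (π : Policy S A) : (t : ℕ) → Measure (History S A t)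
  | 0 => M.init.map (fun s => (Fin.elim0, s))
  | t + 1 => (M.historyLaw π t ⊗ₘ M.stepKernel π t).map (extendHistory t)

instance isProbabilityMeasure_historyLaw (M : MDP S A) (π : Policy S A) (t : ℕ) :
    IsProbabilityMeasure (M.historyLaw π t) := by
  induction t with
  | zero => exact Measure.isProbabilityMeasure_map (by fun_prop)
  | succ t ih => exact Measure.isProbabilityMeasure_map (measurable_extendHistory t).aemeasurable

/-- The expected cumulative cost `L_{M, π} = 𝔼_{π, M}[∑_{t < T} c_t]`. -/
noncomputable def expectedCost (M : MDP S A) (π : Policy S A) (T : ℕ) : ℝ :=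
  ∫ h : History S A T, ∑ t : Fin T, (h.1 t).2.2 ∂(M.historyLaw π T)

end MDP

section BayesianRL

variable {S A : Type*} [MeasurableSpace S] [MeasurableSpace A] {d : ℕ}
  {Θ : Set (EuclideanSpace ℝ (Fin d))}

/-- The parametrization `θ ↦ g θ` of MDPs is measurable. -/
structure IsMeasurableFamily (g : Θ → MDP S A) : Prop where
  init : Measurable fun θ => (g θ).init
  cost : Measurable fun p : Θ × S × A => (g p.1).cost p.2
  trans : Measurable fun p : Θ × S × A => (g p.1).trans p.2
  horizon : Measurable fun θ => (g θ).horizon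

/-- All costs of all MDPs in the family lie in `[0, Cmax]`. -/
def CostsIn (g : Θ → MDP S A) (Cmax : ℝ) : Prop :=
  ∀ θ s a, ∀ᵐ c ∂((g θ).cost (s, a)), c ∈ Set.Icc 0 Cmax

/-- The cost `𝓛_p(π) = ∫_Θ L_{g(θ), π} p(θ) dθ` of the policy `π` for the density `p` on the
parameter space (`Θ` carries Lebesgue measure). Tasks are
defined for `θ ∈ Θ` only, so the part of `p` outside `Θ` plays no role, and multiplying `p` by a
positive constant does not change the minimizers. -/
noncomputable def bayesCost (g : Θ → MDP S A) (T : ℕ) (p : EuclideanSpace ℝ (Fin d) → ℝ)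
    (π : Policy S A) : ℝ :=
  ∫ θ : Θ, (g θ).expectedCost π T * p θ ∂(volume.comap Subtype.val)

/-- `π ∈ argmin 𝓛_p`. -/
def IsBayesOptimal (g : Θ → MDP S A) (T : ℕ) (p : EuclideanSpace ℝ (Fin d) → ℝ)
    (π : Policy S A) : Prop :=
  ∀ π' : Policy S A, bayesCost g T p π ≤ bayesCost g T p π'

/-- The regret `𝓡_T(π) = 𝓛_f(π) - min_{π'} 𝓛_f(π')` for the prior density `f`. -/
noncomputable def regret (g : Θ → MDP S A) (T : ℕ) (f : EuclideanSpace ℝ (Fin d) → ℝ)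
    (π : Policy S A) : ℝ :=
  bayesCost g T f π - ⨅ π' : Policy S A, bayesCost g T f π'

/-- When a Bayes-optimal policy exists, the regret is the excess cost over it. -/
theorem regret_eq_sub_of_isBayesOptimal {g : Θ → MDP S A} {T : ℕ}
    {f : EuclideanSpace ℝ (Fin d) → ℝ} {πBO : Policy S A} (h : IsBayesOptimal g T f πBO)
    (π : Policy S A) : regret g T f π = bayesCost g T f π - bayesCost g T f πBO := by
  have : Nonempty (Policy S A) := ⟨πBO⟩
  unfold regret
  congr 1
  exact le_antisymm (ciInf_le ⟨_, by rintro _ ⟨π', rfl⟩; exact h π'⟩ πBO) (le_ciInf h)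

end BayesianRL

/-- The measure on `ℝ^d` with density `f`. -/
noncomputable def densityMeasure {d : ℕ} (f : EuclideanSpace ℝ (Fin d) → ℝ) :
    Measure (EuclideanSpace ℝ (Fin d)) :=
  (volume : Measure (EuclideanSpace ℝ (Fin d))).withDensity fun x => ENNReal.ofReal (f x)

/-- The Gaussian kernel density estimate with bandwidth `h` from the samples `X`. -/
noncomputable def gaussianKDE {d n : ℕ} (h : ℝ) (X : Fin n → EuclideanSpace ℝ (Fin d))
    (x : EuclideanSpace ℝ (Fin d)) : ℝ :=
  1 / (n * (h * √(2 * Real.pi)) ^ d) * ∑ i, Real.exp (-‖x - X i‖ ^ 2 / (2 * h ^ 2))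

/-- The bandwidth `h* = (log n / n)^{1 / (2α + d)}`. -/
noncomputable def optimalBandwidth (d n : ℕ) (α : ℝ) : ℝ :=
  (Real.log n / n) ^ (1 / (2 * α + d))

/-- `Δ_max(Θ)`, the largest `L₁` distance between two points of `Θ`. -/
noncomputable def l1Diameter {d : ℕ} (Θ : Set (EuclideanSpace ℝ (Fin d))) : ℝ :=
  sSup {r | ∃ x ∈ Θ, ∃ y ∈ Θ, r = ∑ i, |x i - y i|}

/-- The constant `C_d`. -/
noncomputable def kdeConst {d : ℕ} (Θ : Set (EuclideanSpace ℝ (Fin d))) (α Cα : ℝ) : ℝ :=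
  Cα * 2 ^ ((α - 1) / 2)
    + 16 * d * √(Cα * l1Diameter Θ ^ α + 1 / volume.real Θ)
        / (√2 * (2 * Real.pi) ^ ((d : ℝ) / 4))
    + 64 * (d : ℝ) ^ 2 / (2 * Real.pi) ^ ((d : ℝ) / 2)

/-! Two policies differ in expected cost by at most `T * Cmax`, so a minimizer for `p` has regret at
most `T * Cmax` times the `L¹` distance of `f` and `p` on `Θ`; trivially the regret is also at most
`T * Cmax`. With `V = |Θ|` and `q = h ^ α`, it remains to bound the minimum of `1` and the `L¹`
error of the kernel estimate by `2 V q C_d`. The error splits into a bias and a stochastic part.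

Bias. The pointwise bound `C E‖hZ‖ ^ α` grows with the dimension. Averaging over `Θ` avoids this:
replace `f` by its Lipschitz lower envelope `g` with constant `L = α C h ^ (α - 1)`, which loses at
most `(1 - α) C h ^ α`. The mean squared increment of `g` over a Gaussian step is at most `h² ∫
‖∇g‖² ≤ (hL)² V`, without a dimension factor because `E (l Z)² = ‖l‖²`. To reach the gradient, the
energy at scale `h`, divided by `h²`, is shown not to decrease when `h` is divided by `√2`; then the
scale tends to zero, with Rademacher's theorem giving the limit (`LipschitzWith.gaussEnergy_le`).
The two losses add up to exactly `C h ^ α V`.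

Stochastic part. Its mean is bounded by the pointwise variance and `f ≤ F = C Δ ^ α + 1 / V`.
Changing one sample moves the `L¹` deviation by at most `2 / n`, so McDiarmid's inequality adds `√(2
log n / n)` off an event of probability at most `1 / n`.

Rate. The bandwidth gives `log n / n = q² h ^ d`. If the bias bound `B = C q V` is at least `3 / 4`,
the claimed bound exceeds `T * Cmax`. Otherwise the smoothed density keeps mass at least `1 / 4` on
`Θ`, which forces `h ^ d (2π) ^ (d / 2) ≤ 4 V`; this absorbs the McDiarmid term into a multiple of
the variance term. -/

/-! ### Gaussian kernel: semigroup identity, scaling, second moments. -/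

section GaussKernel

open Module

variable {E : Type*} [NormedAddCommGroup E] [InnerProductSpace ℝ E]

/-- The density of the centred Gaussian law with covariance `h ^ 2 • 1`. -/
noncomputable def gaussKernel (h : ℝ) (u : E) : ℝ :=
  1 / (h * √(2 * Real.pi)) ^ finrank ℝ E * Real.exp (-‖u‖ ^ 2 / (2 * h ^ 2))

theorem gaussKernel_nonneg {h : ℝ} (hh : 0 ≤ h) (u : E) : 0 ≤ gaussKernel h u := by
  unfold gaussKernel; positivity

theorem gaussKernel_le {h : ℝ} (hh : 0 ≤ h) (u : E) :
    gaussKernel h u ≤ 1 / (h * √(2 * Real.pi)) ^ finrank ℝ E := by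
  refine mul_le_of_le_one_right (by positivity) (Real.exp_le_one_iff.2 ?_)
  rw [neg_div]
  exact neg_nonpos.2 (by positivity)

theorem gaussKernel_neg (h : ℝ) (u : E) : gaussKernel h (-u) = gaussKernel h u := by
  simp [gaussKernel]

@[fun_prop]
theorem continuous_gaussKernel (h : ℝ) : Continuous (gaussKernel h : E → ℝ) := by
  unfold gaussKernel; fun_prop

theorem gaussKernel_eq (h : ℝ) (u : E) :
    gaussKernel h u
      = 1 / (h * √(2 * Real.pi)) ^ finrank ℝ E * Real.exp (-(1 / (2 * h ^ 2)) * ‖u‖ ^ 2) := by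
  unfold gaussKernel; congr 2; ring

/-- Completing the square, `‖y‖² + ‖u + y‖² = ‖u‖² / 2 + 2 ‖y + u / 2‖²`. Integrated over `y`, this
is the semigroup law that turns scale `h` into `√2 * h`. -/
theorem gaussKernel_mul_gaussKernel_add {h : ℝ} (hh : 0 < h) (u y : E) :
    gaussKernel h y * gaussKernel h (u + y)
      = gaussKernel (√2 * h) u * gaussKernel (h / √2) (y + (1 / 2 : ℝ) • u) := by
  have h2 : (√2 : ℝ) ^ 2 = 2 := Real.sq_sqrt (by norm_num)
  have h2' : (√2 : ℝ) ≠ 0 := by positivity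
  unfold gaussKernel
  have e1 : ‖u + y‖ ^ 2 = ‖u‖ ^ 2 + 2 * inner ℝ u y + ‖y‖ ^ 2 := norm_add_sq_real u y
  have e2 : ‖y + (1 / 2 : ℝ) • u‖ ^ 2 = ‖y‖ ^ 2 + inner ℝ u y + ‖u‖ ^ 2 / 4 := by
    rw [norm_add_sq_real, inner_smul_right, norm_smul, real_inner_comm]
    norm_num
    ring
  have e3 : (√2 * h * √(2 * Real.pi)) * (h / √2 * √(2 * Real.pi))
      = (h * √(2 * Real.pi)) * (h * √(2 * Real.pi)) := by field_simp
  rw [mul_mul_mul_comm, mul_mul_mul_comm (1 / (√2 * h * √(2 * Real.pi)) ^ finrank ℝ E),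
    one_div_mul_one_div, one_div_mul_one_div, ← mul_pow, ← mul_pow, e3, ← Real.exp_add,
    ← Real.exp_add, e1, e2]
  congr 2
  rw [mul_pow, div_pow, h2]
  field_simp
  ring

theorem gaussKernel_sq {h : ℝ} (hh : 0 < h) (u : E) :
    gaussKernel h u ^ 2
      = 1 / (h * √(4 * Real.pi)) ^ finrank ℝ E * gaussKernel (h / √2) u := by
  have h4 : √(4 * Real.pi) = √2 * √(2 * Real.pi) := by
    rw [← Real.sqrt_mul (by norm_num)]; ring_nf
  have h2 : (√2 : ℝ) ^ 2 = 2 := Real.sq_sqrt (by norm_num)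
  have h2' : (√2 : ℝ) ≠ 0 := by positivity
  unfold gaussKernel
  rw [← mul_assoc, one_div_mul_one_div, ← mul_pow, h4, mul_pow, div_pow, one_pow, ← pow_mul,
    mul_comm _ 2, pow_mul, ← Real.exp_nat_mul]
  congr 2
  · congr 2; field_simp
  · rw [div_pow, h2]; push_cast; field_simp

theorem gaussKernel_smul {h : ℝ} (hh : 0 < h) (u : E) :
    gaussKernel h (h • u) = (h ^ finrank ℝ E)⁻¹ * gaussKernel 1 u := by
  unfold gaussKernel
  rw [norm_smul, Real.norm_of_nonneg hh.le, mul_pow, mul_pow, one_mul, ← mul_assoc]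
  congr 2
  · field_simp
  · field_simp

theorem hasFDerivAt_gaussKernel_one (z : E) :
    HasFDerivAt (gaussKernel 1 : E → ℝ) (-(gaussKernel 1 z) • innerSL ℝ z) z := by
  have h1 : HasFDerivAt (fun z : E => -‖z‖ ^ 2 / (2 * 1 ^ 2)) (-(innerSL ℝ z)) z := by
    have := ((hasStrictFDerivAt_norm_sq z).hasFDerivAt.const_mul (-(1 / 2) : ℝ))
    rw [show (fun z : E => -‖z‖ ^ 2 / (2 * 1 ^ 2)) = fun z => -(1 / 2) * ‖z‖ ^ 2 by
      funext y; ring]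
    exact this.congr_fderiv (by ext y; simp)
  exact (h1.exp.const_mul (1 / (1 * √(2 * Real.pi)) ^ finrank ℝ E)).congr_fderiv
    (by ext y; simp [gaussKernel, mul_assoc])

variable [MeasurableSpace E] [BorelSpace E]

@[fun_prop]
theorem measurable_gaussKernel (h : ℝ) : Measurable (gaussKernel h : E → ℝ) :=
  (continuous_gaussKernel h).measurable

variable [FiniteDimensional ℝ E]

theorem integrable_exp_neg_mul_sq_norm {b : ℝ} (hb : 0 < b) :
    Integrable (fun v : E => Real.exp (-b * ‖v‖ ^ 2)) := by
  -- A non-integrable function has integral `0` by convention, but the closed formula for this one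
  -- is positive.
  by_contra hn
  have h1 := GaussianFourier.integral_rexp_neg_mul_sq_norm (V := E) hb
  rw [integral_undef hn] at h1
  have : 0 < (Real.pi / b) ^ (finrank ℝ E / 2 : ℝ) := by positivity
  exact this.ne h1

theorem integrable_gaussKernel {h : ℝ} (hh : 0 < h) : Integrable (gaussKernel h : E → ℝ) := by
  have := (integrable_exp_neg_mul_sq_norm (E := E) (b := 1 / (2 * h ^ 2)) (by positivity)).const_mul
    (1 / (h * √(2 * Real.pi)) ^ finrank ℝ E)
  exact this.congr (.of_forall fun u => (gaussKernel_eq h u).symm)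

theorem integral_gaussKernel {h : ℝ} (hh : 0 < h) : ∫ u : E, gaussKernel h u = 1 := by
  simp only [gaussKernel_eq]
  rw [integral_const_mul, GaussianFourier.integral_rexp_neg_mul_sq_norm (by positivity)]
  have : Real.pi / (1 / (2 * h ^ 2)) = (h * √(2 * Real.pi)) ^ 2 := by
    rw [mul_pow, Real.sq_sqrt (by positivity)]; field_simp
  rw [this, ← Real.rpow_natCast, ← Real.rpow_natCast, ← Real.rpow_mul (by positivity)]
  have : ((2 : ℕ) : ℝ) * (finrank ℝ E / 2 : ℝ) = finrank ℝ E := by push_cast; ring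
  rw [this]
  have : 0 < (h * √(2 * Real.pi)) ^ (finrank ℝ E : ℝ) := by positivity
  field_simp

theorem lintegral_gaussKernel {h : ℝ} (hh : 0 < h) :
    ∫⁻ u : E, ENNReal.ofReal (gaussKernel h u) = 1 := by
  rw [← ofReal_integral_eq_lintegral_ofReal (integrable_gaussKernel hh)
    (.of_forall (gaussKernel_nonneg hh.le)), integral_gaussKernel hh, ENNReal.ofReal_one]

theorem lintegral_gaussKernel_mul_gaussKernel_add {h : ℝ} (hh : 0 < h) (u : E) :
    ∫⁻ y : E, ENNReal.ofReal (gaussKernel h y) * ENNReal.ofReal (gaussKernel h (u + y))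
      = ENNReal.ofReal (gaussKernel (√2 * h) u) := by
  simp_rw [← ENNReal.ofReal_mul (gaussKernel_nonneg hh.le _), gaussKernel_mul_gaussKernel_add hh,
    ENNReal.ofReal_mul (gaussKernel_nonneg (by positivity : 0 ≤ √2 * h) _)]
  rw [lintegral_const_mul' _ _ ENNReal.ofReal_ne_top,
    lintegral_add_right_eq_self (fun y : E => ENNReal.ofReal (gaussKernel (h / √2) y)),
    lintegral_gaussKernel (by positivity), mul_one]

/-- Dilation by `h` is a measurable equivalence, so `φ` needs no measurability. -/
theorem lintegral_gaussKernel_mul {h : ℝ} (hh : 0 < h) (φ : E → ENNReal) :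
    ∫⁻ y : E, ENNReal.ofReal (gaussKernel h y) * φ y
      = ∫⁻ y : E, ENNReal.ofReal (gaussKernel 1 y) * φ (h • y) := by
  have hne : h ≠ 0 := hh.ne'
  have h1 : ∀ ψ : E → ENNReal, ∫⁻ y, ψ (h • y)
      = ENNReal.ofReal ((h ^ finrank ℝ E)⁻¹) * ∫⁻ y, ψ y := by
    intro ψ
    have := Measure.map_addHaar_smul (volume : Measure E) hne
    have h2 : ∫⁻ y, ψ y ∂(Measure.map (h • ·) (volume : Measure E)) = ∫⁻ y, ψ (h • y) :=
      lintegral_map_equiv ψ (Homeomorph.smulOfNeZero h hne).toMeasurableEquiv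
    rw [← h2, this, lintegral_smul_measure, abs_of_pos (by positivity), smul_eq_mul]
  have hp : ENNReal.ofReal (h ^ finrank ℝ E) * ENNReal.ofReal ((h ^ finrank ℝ E)⁻¹) = 1 := by
    rw [← ENNReal.ofReal_mul (by positivity), mul_inv_cancel₀ (by positivity), ENNReal.ofReal_one]
  have h3 := h1 fun y => ENNReal.ofReal (gaussKernel h y) * φ y
  simp only [gaussKernel_smul hh,
    ENNReal.ofReal_mul (by positivity : 0 ≤ (h ^ finrank ℝ E)⁻¹), mul_assoc] at h3
  rw [lintegral_const_mul' _ _ ENNReal.ofReal_ne_top] at h3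
  have := congrArg (ENNReal.ofReal (h ^ finrank ℝ E) * ·) h3
  simpa only [← mul_assoc, hp, one_mul] using this.symm

theorem integrable_sq_norm_mul_gaussKernel :
    Integrable (fun z : E => ‖z‖ ^ 2 * gaussKernel 1 z) := by
  have := (integrable_exp_neg_mul_sq_norm (E := E) (b := 1 / 4) (by positivity)).const_mul
    (4 * (1 / (1 * √(2 * Real.pi)) ^ finrank ℝ E))
  refine this.mono' (by
    have := continuous_gaussKernel (E := E) 1
    exact Continuous.aestronglyMeasurable (by fun_prop)) (.of_forall fun z => ?_)
  rw [Real.norm_of_nonneg (mul_nonneg (sq_nonneg _) (gaussKernel_nonneg zero_le_one z))]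
  unfold gaussKernel
  -- Half of the exponent absorbs the polynomial factor: `s * exp (-s) ≤ 1` at `s = ‖z‖² / 4`.
  have h1 : ‖z‖ ^ 2 * Real.exp (-‖z‖ ^ 2 / (2 * 1 ^ 2)) ≤ 4 * Real.exp (-(1 / 4) * ‖z‖ ^ 2) := by
    have e : Real.exp (-‖z‖ ^ 2 / (2 * 1 ^ 2))
        = Real.exp (-(1 / 4) * ‖z‖ ^ 2) * Real.exp (-(‖z‖ ^ 2 / 4)) := by
      rw [← Real.exp_add]; ring_nf
    have h2 : ‖z‖ ^ 2 / 4 * Real.exp (-(‖z‖ ^ 2 / 4)) ≤ 1 := by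
      rw [Real.exp_neg, ← div_eq_mul_inv, div_le_one (Real.exp_pos _)]
      linarith [Real.add_one_le_exp (‖z‖ ^ 2 / 4)]
    rw [e]
    nlinarith [Real.exp_pos (-(1 / 4) * ‖z‖ ^ 2)]
  calc _ = (1 / (1 * √(2 * Real.pi)) ^ finrank ℝ E)
        * (‖z‖ ^ 2 * Real.exp (-‖z‖ ^ 2 / (2 * 1 ^ 2))) := by ring
    _ ≤ (1 / (1 * √(2 * Real.pi)) ^ finrank ℝ E) * (4 * Real.exp (-(1 / 4) * ‖z‖ ^ 2)) := by gcongr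
    _ = _ := by ring

/-- Gaussian integration by parts: the kernel has gradient `-z` times itself, so one factor `⟨w, z⟩`
is moved onto the other as a derivative in direction `w`. No factor of the dimension appears, which
is what keeps the bias bound dimension-free. -/
theorem integral_inner_sq_mul_gaussKernel (w : E) :
    ∫ z : E, inner ℝ w z ^ 2 * gaussKernel 1 z = ‖w‖ ^ 2 := by
  have hfd : ∀ z, fderiv ℝ (gaussKernel 1 : E → ℝ) z w = -(gaussKernel 1 z) * inner ℝ w z := by
    intro z; rw [(hasFDerivAt_gaussKernel_one z).fderiv]; simp [real_inner_comm]
  have hfd' : ∀ z : E, fderiv ℝ (fun z : E => inner ℝ w z) z w = ‖w‖ ^ 2 := by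
    intro z
    have : HasFDerivAt (fun z : E => inner ℝ w z) (innerSL ℝ w) z := (innerSL ℝ w).hasFDerivAt
    rw [this.fderiv]; simp
  have hc := continuous_gaussKernel (E := E) 1
  have hi0 := integrable_gaussKernel (E := E) one_pos
  have hi2 := integrable_sq_norm_mul_gaussKernel (E := E)
  have hb : ∀ z : E, |inner ℝ w z| ≤ ‖w‖ * ‖z‖ := fun z => abs_real_inner_le_norm w z
  have key := integral_mul_fderiv_eq_neg_fderiv_mul_of_integrable (μ := (volume : Measure E))
    (f := fun z : E => inner ℝ w z) (g := gaussKernel 1) (v := w) (𝕜 := ℝ)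
    (by simp only [hfd']; exact hi0.const_mul _)
    (by
      simp only [hfd]
      refine (hi2.const_mul (‖w‖ ^ 2)).mono'
        (Continuous.aestronglyMeasurable (by fun_prop)) (.of_forall fun z => ?_)
      rw [Real.norm_eq_abs, abs_mul, abs_mul, abs_neg,
        abs_of_nonneg (gaussKernel_nonneg zero_le_one z)]
      have := gaussKernel_nonneg zero_le_one z
      nlinarith [mul_self_le_mul_self (abs_nonneg _) (hb z)])
    (by
      refine ((hi0.add hi2).const_mul ‖w‖).mono'
        (Continuous.aestronglyMeasurable (by fun_prop)) (.of_forall fun z => ?_)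
      have hk := gaussKernel_nonneg zero_le_one z
      rw [Real.norm_eq_abs, abs_mul, abs_of_nonneg hk]
      have : ‖z‖ ≤ 1 + ‖z‖ ^ 2 := by nlinarith [sq_nonneg (‖z‖ - 1)]
      calc _ ≤ ‖w‖ * ‖z‖ * gaussKernel 1 z := by gcongr; exact hb z
        _ ≤ ‖w‖ * (1 + ‖z‖ ^ 2) * gaussKernel 1 z := by gcongr
        _ = _ := by simp only [Pi.add_apply]; ring)
    (fun z _ => (innerSL ℝ w).differentiableAt)
    (fun z _ => (hasFDerivAt_gaussKernel_one z).differentiableAt)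
  simp only [hfd, hfd', integral_const_mul, integral_gaussKernel one_pos, mul_one] at key
  rw [← neg_eq_iff_eq_neg, ← integral_neg] at key
  rw [← key]
  congr 1; ext z; ring

theorem lintegral_clm_sq_mul_gaussKernel (l : E →L[ℝ] ℝ) :
    ∫⁻ z : E, ENNReal.ofReal (gaussKernel 1 z) * ENNReal.ofReal (l z ^ 2)
      = ENNReal.ofReal (‖l‖ ^ 2) := by
  obtain ⟨w, rfl⟩ := (InnerProductSpace.toDual ℝ E).surjective l
  have hc := continuous_gaussKernel (E := E) 1
  have h0 : ∀ z : E, 0 ≤ inner ℝ w z ^ 2 * gaussKernel 1 z := fun z =>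
    mul_nonneg (sq_nonneg _) (gaussKernel_nonneg zero_le_one z)
  rw [LinearIsometryEquiv.norm_map, ← integral_inner_sq_mul_gaussKernel,
    ofReal_integral_eq_lintegral_ofReal _ (.of_forall h0)]
  · refine lintegral_congr fun z => ?_
    rw [mul_comm, ← ENNReal.ofReal_mul (sq_nonneg _)]; simp
  · refine ((integrable_sq_norm_mul_gaussKernel (E := E)).const_mul (‖w‖ ^ 2)).mono'
      (Continuous.aestronglyMeasurable (by fun_prop)) (.of_forall fun z => ?_)
    rw [Real.norm_of_nonneg (h0 z), ← mul_assoc, ← mul_pow, ← sq_abs]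
    have := gaussKernel_nonneg zero_le_one z
    gcongr
    exact abs_real_inner_le_norm w z

end GaussKernel

/-! ### Gaussian increments at dyadically related scales. -/

section GaussEnergy

open Module Filter Topology

variable {E : Type*} [NormedAddCommGroup E] [InnerProductSpace ℝ E] [FiniteDimensional ℝ E]
  [MeasurableSpace E] [BorelSpace E]

/-- The mean squared increment of `g` over a centred Gaussian displacement of variance `h ^ 2`. -/
noncomputable def gaussEnergy (h : ℝ) (g : E → ℝ) : ENNReal :=
  ∫⁻ y, ENNReal.ofReal (gaussKernel h y) * ∫⁻ x, ENNReal.ofReal ((g (x + y) - g x) ^ 2)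

/-- The correlation of `G` with its Gaussian average. -/
noncomputable def gaussCorrelation (h : ℝ) (G : E → ENNReal) : ENNReal :=
  ∫⁻ y, ENNReal.ofReal (gaussKernel h y) * ∫⁻ x, G x * G (x + y)

theorem ENNReal.two_mul_mul_le_sq_add_sq (a b : ENNReal) : 2 * (a * b) ≤ a ^ 2 + b ^ 2 := by
  wlog h : a ≤ b generalizing a b
  · rw [mul_comm a b, add_comm]
    exact this b a (le_of_not_ge h)
  obtain ⟨c, rfl⟩ := exists_add_of_le h
  calc 2 * (a * (a + c)) ≤ 2 * (a * (a + c)) + c ^ 2 := le_self_add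
    _ = a ^ 2 + (a + c) ^ 2 := by ring

/-- Expand the square and use translation invariance. The correlation stays on the left because
subtraction in `ENNReal` is truncated. -/
theorem gaussEnergy_add_two_mul_gaussCorrelation {h : ℝ} (hh : 0 < h) {g : E → ℝ}
    (hg : Measurable g) (hg0 : ∀ x, 0 ≤ g x) :
    gaussEnergy h g + 2 * gaussCorrelation h (fun x => ENNReal.ofReal (g x))
      = 2 * ∫⁻ x, ENNReal.ofReal (g x) ^ 2 := by
  have hk := (measurable_gaussKernel (E := E) h).ennreal_ofReal
  unfold gaussEnergy gaussCorrelation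
  rw [← lintegral_const_mul' _ _ (by norm_num), ← lintegral_add_right]
  · have : ∀ y : E, ENNReal.ofReal (gaussKernel h y)
          * (∫⁻ x, ENNReal.ofReal ((g (x + y) - g x) ^ 2))
        + 2 * (ENNReal.ofReal (gaussKernel h y)
          * ∫⁻ x, ENNReal.ofReal (g x) * ENNReal.ofReal (g (x + y)))
        = ENNReal.ofReal (gaussKernel h y) * (2 * ∫⁻ x, ENNReal.ofReal (g x) ^ 2) := by
      intro y
      rw [mul_left_comm, ← mul_add]
      congr 1
      rw [← lintegral_const_mul' _ _ (by norm_num), ← lintegral_add_right _ (by fun_prop), two_mul]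
      nth_rw 2 [← lintegral_add_right_eq_self (fun x => ENNReal.ofReal (g x) ^ 2) y]
      rw [← lintegral_add_right _ (by fun_prop)]
      refine lintegral_congr fun x => ?_
      rw [← ENNReal.ofReal_mul (hg0 _), ← ENNReal.ofReal_pow (hg0 _), ← ENNReal.ofReal_pow (hg0 _),
        ← ENNReal.ofReal_add (sq_nonneg _) (sq_nonneg _), two_mul,
        ← ENNReal.ofReal_add (mul_nonneg (hg0 _) (hg0 _)) (mul_nonneg (hg0 _) (hg0 _)),
        ← ENNReal.ofReal_add (sq_nonneg _)
          (add_nonneg (mul_nonneg (hg0 _) (hg0 _)) (mul_nonneg (hg0 _) (hg0 _)))]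
      congr 1; ring
    simp_rw [this]
    rw [lintegral_mul_const _ hk, lintegral_gaussKernel hh, one_mul]
  · refine (hk.mul ?_).const_mul _
    exact Measurable.lintegral_prod_right' (f := fun p : E × E =>
      ENNReal.ofReal (g p.2) * ENNReal.ofReal (g (p.2 + p.1))) (by fun_prop)

/-- Smoothing is symmetric and smoothing twice at scale `h` is smoothing once at scale `√2 * h`, so
the squared norm of the average is a correlation. Working in `ENNReal`, every interchange is
Tonelli. -/
theorem lintegral_gaussAverage_sq {h : ℝ} (hh : 0 < h) {G : E → ENNReal} (hG : Measurable G) :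
    ∫⁻ x, (∫⁻ y, ENNReal.ofReal (gaussKernel h y) * G (x + y)) ^ 2
      = gaussCorrelation (√2 * h) G := by
  have hk := (measurable_gaussKernel (E := E) h).ennreal_ofReal
  set k : E → ENNReal := fun y => ENNReal.ofReal (gaussKernel h y) with hkdef
  have hc : Measurable fun u : E => ∫⁻ x, G x * G (x + u) :=
    Measurable.lintegral_prod_right' (f := fun p : E × E => G p.2 * G (p.2 + p.1)) (by fun_prop)
  calc ∫⁻ x, (∫⁻ y, k y * G (x + y)) ^ 2
      = ∫⁻ x, ∫⁻ y, ∫⁻ z, (k y * G (x + y)) * (k z * G (x + z)) := by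
        refine lintegral_congr fun x => ?_
        rw [sq, ← lintegral_mul_const _ (by fun_prop)]
        refine lintegral_congr fun y => ?_
        rw [lintegral_const_mul _ (by fun_prop)]
    _ = ∫⁻ y, ∫⁻ x, ∫⁻ z, (k y * G (x + y)) * (k z * G (x + z)) := by
        rw [lintegral_lintegral_swap]
        exact (Measurable.lintegral_prod_right' (f := fun p : (E × E) × E =>
          (k p.1.2 * G (p.1.1 + p.1.2)) * (k p.2 * G (p.1.1 + p.2))) (by fun_prop)).aemeasurable
    _ = ∫⁻ y, ∫⁻ z, ∫⁻ x, (k y * G (x + y)) * (k z * G (x + z)) := by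
        refine lintegral_congr fun y => ?_
        rw [lintegral_lintegral_swap]
        exact Measurable.aemeasurable (by fun_prop)
    _ = ∫⁻ y, ∫⁻ z, k y * k z * ∫⁻ x, G x * G (x + (z - y)) := by
        refine lintegral_congr fun y => lintegral_congr fun z => ?_
        rw [← lintegral_const_mul _ (by fun_prop),
          ← lintegral_add_right_eq_self (fun x => k y * k z * (G x * G (x + (z - y)))) y]
        refine lintegral_congr fun x => ?_
        rw [show x + y + (z - y) = x + z by abel]; ring
    _ = ∫⁻ y, ∫⁻ u, k y * k (u + y) * ∫⁻ x, G x * G (x + u) := by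
        refine lintegral_congr fun y => ?_
        rw [← lintegral_add_right_eq_self _ y]
        simp only [add_sub_cancel_right]
    _ = ∫⁻ u, ∫⁻ y, k y * k (u + y) * ∫⁻ x, G x * G (x + u) := by
        rw [lintegral_lintegral_swap]
        exact Measurable.aemeasurable (by fun_prop)
    _ = gaussCorrelation (√2 * h) G := by
        refine lintegral_congr fun u => ?_
        rw [lintegral_mul_const _ (by fun_prop), lintegral_gaussKernel_mul_gaussKernel_add hh]

theorem two_mul_gaussCorrelation_le {h : ℝ} (hh : 0 < h) {G : E → ENNReal} (hG : Measurable G) :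
    2 * gaussCorrelation h G ≤ (∫⁻ x, G x ^ 2) + gaussCorrelation (√2 * h) G := by
  have hk := (measurable_gaussKernel (E := E) h).ennreal_ofReal
  have h1 : gaussCorrelation h G
      = ∫⁻ x, G x * ∫⁻ y, ENNReal.ofReal (gaussKernel h y) * G (x + y) := by
    unfold gaussCorrelation
    simp_rw [← lintegral_const_mul' _ _ ENNReal.ofReal_ne_top]
    rw [lintegral_lintegral_swap (Measurable.aemeasurable (by fun_prop))]
    refine lintegral_congr fun x => ?_
    rw [← lintegral_const_mul _ (by fun_prop)]
    exact lintegral_congr fun y => mul_left_comm _ _ _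
  rw [← lintegral_gaussAverage_sq hh hG, h1, ← lintegral_add_left (by fun_prop),
    ← lintegral_const_mul' _ _ (by norm_num)]
  exact lintegral_mono fun x => ENNReal.two_mul_mul_le_sq_add_sq _ _

/-- With `c = ‖g‖²` and `C₁`, `C₂` the correlations at scales `h` and `√2 * h`, the energies are `2
(c - C₁)` and `2 (c - C₂)`. The claim is `2 C₁ ≤ c + C₂`, that is `2 ⟨g, Kg⟩ ≤ ‖g‖² + ‖Kg‖²` for the
smoothing operator `K`. -/
theorem gaussEnergy_sqrt_two_mul_le {h : ℝ} (hh : 0 < h) {g : E → ℝ} (hg : Measurable g)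
    (hg0 : ∀ x, 0 ≤ g x) (hg2 : ∫⁻ x, ENNReal.ofReal (g x) ^ 2 ≠ ⊤) :
    gaussEnergy (√2 * h) g ≤ 2 * gaussEnergy h g := by
  have e1 := gaussEnergy_add_two_mul_gaussCorrelation hh hg hg0
  have e2 := gaussEnergy_add_two_mul_gaussCorrelation (by positivity : 0 < √2 * h) hg hg0
  have e3 := two_mul_gaussCorrelation_le hh hg.ennreal_ofReal
  generalize gaussEnergy (√2 * h) g = A2 at *
  generalize gaussEnergy h g = A1 at *
  generalize gaussCorrelation h (fun x => ENNReal.ofReal (g x)) = C1 at *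
  generalize gaussCorrelation (√2 * h) (fun x => ENNReal.ofReal (g x)) = C2 at *
  generalize ∫⁻ x, ENNReal.ofReal (g x) ^ 2 = c at *
  have hc : 2 * c ≠ ⊤ := ENNReal.mul_ne_top (by norm_num) hg2
  have hA1 : A1 ≠ ⊤ := ne_top_of_le_ne_top hc (e1 ▸ le_self_add)
  have hA2 : A2 ≠ ⊤ := ne_top_of_le_ne_top hc (e2 ▸ le_self_add)
  have hC1 : C1 ≠ ⊤ := fun h => by simp [h] at e1; exact hc (by rw [← e1])
  have hC2 : C2 ≠ ⊤ := fun h => by simp [h] at e2; exact hc (by rw [← e2])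
  lift A1 to NNReal using hA1
  lift A2 to NNReal using hA2
  lift C1 to NNReal using hC1
  lift C2 to NNReal using hC2
  lift c to NNReal using hg2
  norm_cast at *
  rw [← NNReal.coe_inj] at e1 e2
  rw [← NNReal.coe_le_coe] at *
  push_cast at *
  linarith

theorem gaussEnergy_le_two_pow_mul {h : ℝ} (hh : 0 < h) {g : E → ℝ} (hg : Measurable g)
    (hg0 : ∀ x, 0 ≤ g x) (hg2 : ∫⁻ x, ENNReal.ofReal (g x) ^ 2 ≠ ⊤) (k : ℕ) :
    gaussEnergy h g ≤ 2 ^ k * gaussEnergy (h / √2 ^ k) g := by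
  induction k with
  | zero => simp
  | succ k ih =>
    refine ih.trans ?_
    rw [pow_succ, mul_assoc]
    gcongr
    have := gaussEnergy_sqrt_two_mul_le (by positivity : 0 < h / √2 ^ (k + 1)) hg hg0 hg2
    rwa [show √2 * (h / √2 ^ (k + 1)) = h / √2 ^ k by rw [pow_succ]; field_simp] at this

theorem gaussEnergy_eq_rescale {h : ℝ} (hh : 0 < h) (g : E → ℝ) :
    gaussEnergy h g = ENNReal.ofReal (h ^ 2) * ∫⁻ z, ENNReal.ofReal (gaussKernel 1 z)
      * ∫⁻ x, ENNReal.ofReal (((g (x + h • z) - g x) / h) ^ 2) := by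
  unfold gaussEnergy
  rw [lintegral_gaussKernel_mul hh, ← lintegral_const_mul' _ _ ENNReal.ofReal_ne_top]
  refine lintegral_congr fun z => ?_
  rw [mul_left_comm, ← lintegral_const_mul' (ENNReal.ofReal (h ^ 2)) _ ENNReal.ofReal_ne_top]
  congr 1
  refine lintegral_congr fun x => ?_
  rw [← ENNReal.ofReal_mul (sq_nonneg _)]
  congr 1; field_simp

end GaussEnergy

/-! ### From Gaussian increments to the gradient of a Lipschitz function. -/

section GradientBound

open Module Filter Topology

variable {E : Type*} [NormedAddCommGroup E] [InnerProductSpace ℝ E]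

theorem LipschitzWith.sq_div_le {L : NNReal} {g : E → ℝ} (hg : LipschitzWith L g) {ε : ℝ}
    (hε : 0 < ε) (x z : E) : ((g (x + ε • z) - g x) / ε) ^ 2 ≤ (L * ‖z‖) ^ 2 := by
  rw [← sq_abs]
  have h := hg.dist_le_mul (x + ε • z) x
  rw [Real.dist_eq, dist_eq_norm, add_sub_cancel_left, norm_smul, Real.norm_of_nonneg hε.le] at h
  gcongr
  rw [abs_div, abs_of_pos hε, div_le_iff₀ hε]
  linarith

variable [FiniteDimensional ℝ E] [MeasurableSpace E] [BorelSpace E]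

/-- The increment vanishes unless one endpoint lies in the ball. The bound does not depend on `ε`
and is integrable in `z` against the Gaussian, hence serves as a dominating function. -/
theorem lintegral_sq_increment_le {L : NNReal} {g : E → ℝ} (hg : LipschitzWith L g) {R : ℝ}
    (hR : ∀ x ∉ Metric.closedBall (0 : E) R, g x = 0) {ε : ℝ} (hε : 0 < ε) (z : E) :
    ∫⁻ x, ENNReal.ofReal (((g (x + ε • z) - g x) / ε) ^ 2)
      ≤ ENNReal.ofReal ((L * ‖z‖) ^ 2) * (2 * volume (Metric.closedBall (0 : E) R)) := by
  set B := Metric.closedBall (0 : E) R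
  set b : E → ENNReal := B.indicator 1 with hb
  have hB : MeasurableSet B := Metric.isClosed_closedBall.measurableSet
  have hbm : Measurable b := measurable_one.indicator hB
  calc ∫⁻ x, ENNReal.ofReal (((g (x + ε • z) - g x) / ε) ^ 2)
      ≤ ∫⁻ x, ENNReal.ofReal ((L * ‖z‖) ^ 2) * (b x + b (x + ε • z)) := by
        refine lintegral_mono fun x => ?_
        by_cases h : x ∈ B ∨ x + ε • z ∈ B
        · calc _ ≤ ENNReal.ofReal ((L * ‖z‖) ^ 2) * 1 := by
                rw [mul_one]; exact ENNReal.ofReal_le_ofReal (hg.sq_div_le hε x z)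
            _ ≤ _ := by
                gcongr
                rcases h with h | h
                · exact le_add_right (by simp [hb, h])
                · exact le_add_left (by simp [hb, h])
        · push Not at h
          simp [hR _ h.1, hR _ h.2]
    _ = _ := by
        rw [lintegral_const_mul _ (by fun_prop), lintegral_add_left hbm,
          lintegral_add_right_eq_self b, two_mul, hb, lintegral_indicator_one hB]

theorem tendsto_lintegral_sq_increment {L : NNReal} {g : E → ℝ} (hg : LipschitzWith L g) {R : ℝ}
    (hR : ∀ x ∉ Metric.closedBall (0 : E) R, g x = 0) {ε : ℕ → ℝ} (hε : ∀ k, 0 < ε k)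
    {h : ℝ} (hεh : ∀ k, ε k ≤ h) (hε0 : Tendsto ε atTop (𝓝 0)) (z : E) :
    Tendsto (fun k => ∫⁻ x, ENNReal.ofReal (((g (x + ε k • z) - g x) / ε k) ^ 2)) atTop
      (𝓝 (∫⁻ x, ENNReal.ofReal (fderiv ℝ g x z ^ 2))) := by
  have hgm : Measurable g := hg.continuous.measurable
  -- For `x` outside this larger ball, neither `x` nor `x + ε k • z` meets the support.
  set B := Metric.closedBall (0 : E) (R + h * ‖z‖)
  have hB : MeasurableSet B := Metric.isClosed_closedBall.measurableSet
  refine tendsto_lintegral_of_dominated_convergence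
    (B.indicator fun _ => ENNReal.ofReal ((L * ‖z‖) ^ 2)) (fun k => by fun_prop)
    (fun k => .of_forall fun x => ?_) ?_ ?_
  · by_cases hx : x ∈ B
    · rw [Set.indicator_of_mem hx]
      exact ENNReal.ofReal_le_ofReal (hg.sq_div_le (hε k) x z)
    · have hz : ‖ε k • z‖ ≤ h * ‖z‖ := by
        rw [norm_smul, Real.norm_of_nonneg (hε k).le]; gcongr; exact hεh k
      have hh : 0 ≤ h * ‖z‖ := (norm_nonneg _).trans hz
      simp only [B, Metric.mem_closedBall, dist_zero_right, not_le] at hx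
      have h1 : g x = 0 := hR x (by simp; linarith)
      have h2 : g (x + ε k • z) = 0 := hR _ (by
        simp only [Metric.mem_closedBall, dist_zero_right, not_le]
        have := norm_le_norm_add_norm_sub' x (x + ε k • z)
        rw [sub_add_cancel_left, norm_neg] at this
        linarith)
      simp [h1, h2]
  · rw [lintegral_indicator hB, setLIntegral_const]
    exact ENNReal.mul_ne_top ENNReal.ofReal_ne_top
      (Metric.isBounded_closedBall.measure_lt_top).ne
  · filter_upwards [hg.ae_differentiableAt] with x hx
    have h1 := (hx.hasFDerivAt.hasLineDerivAt z).tendsto_slope_zero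
    have h2 : Tendsto ε atTop (𝓝[≠] 0) :=
      tendsto_nhdsWithin_iff.2 ⟨hε0, .of_forall fun k => (hε k).ne'⟩
    have h3 := (ENNReal.continuous_ofReal.tendsto _).comp ((h1.comp h2).pow 2)
    refine h3.congr fun k => ?_
    simp [div_eq_inv_mul]

theorem measurable_fderiv_apply_prod (g : E → ℝ) :
    Measurable fun p : E × E => fderiv ℝ g p.1 p.2 := by
  have h : Measurable fun p : E × E => ((fderiv ℝ g p.1, p.2) : (E →L[ℝ] ℝ) × E) :=
    ((measurable_fderiv ℝ g).comp measurable_fst).prodMk measurable_snd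
  exact (isBoundedBilinearMap_apply (𝕜 := ℝ) (E := E) (F := ℝ)).continuous.measurable.comp h

/-- At a zero, the nonnegative `g` has a minimum, so its derivative vanishes. The gradient thus
lives on `s` up to a null set, whatever the boundary of `s` looks like. -/
theorem lintegral_sq_norm_fderiv_le {L : NNReal} {g : E → ℝ} (hg : LipschitzWith L g)
    (hg0 : ∀ x, 0 ≤ g x) {s : Set E} (hs : MeasurableSet s) (hgs : ∀ᵐ x, x ∉ s → g x = 0) :
    ∫⁻ x, ENNReal.ofReal (‖fderiv ℝ g x‖ ^ 2) ≤ ENNReal.ofReal (L ^ 2) * volume s := by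
  rw [← lintegral_indicator_const hs]
  refine lintegral_mono_ae ?_
  filter_upwards [hgs] with x hx
  by_cases h : x ∈ s
  · rw [Set.indicator_of_mem h]
    have := norm_fderiv_le_of_lipschitz ℝ hg (x₀ := x)
    gcongr
  · have : IsLocalMin g x := .of_forall fun y => (hx h).symm ▸ hg0 y
    simp [this.fderiv_eq_zero, h]

theorem LipschitzWith.gaussEnergy_le {L : NNReal} {g : E → ℝ} (hg : LipschitzWith L g)
    (hg0 : ∀ x, 0 ≤ g x) {s : Set E} (hs : MeasurableSet s) (hgs : ∀ᵐ x, x ∉ s → g x = 0) {R : ℝ}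
    (hR : ∀ x ∉ Metric.closedBall (0 : E) R, g x = 0) {h : ℝ} (hh : 0 < h) :
    gaussEnergy h g ≤ ENNReal.ofReal ((h * L) ^ 2) * volume s := by
  have hgm : Measurable g := hg.continuous.measurable
  set B := Metric.closedBall (0 : E) R with hBdef
  have hB : MeasurableSet B := Metric.isClosed_closedBall.measurableSet
  have hBt : volume B ≠ ⊤ := (Metric.isBounded_closedBall.measure_lt_top).ne
  have hg2 : ∫⁻ x, ENNReal.ofReal (g x) ^ 2 ≠ ⊤ := by
    obtain ⟨C, hC⟩ := (isCompact_closedBall (0 : E) R).exists_bound_of_continuousOn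
      hg.continuous.continuousOn
    refine ne_top_of_le_ne_top (b := ∫⁻ x, B.indicator (fun _ => ENNReal.ofReal C ^ 2) x) ?_
      (lintegral_mono fun x => ?_)
    · rw [lintegral_indicator_const hB]
      exact ENNReal.mul_ne_top (by simp) hBt
    · by_cases hx : x ∈ B
      · rw [Set.indicator_of_mem hx]
        gcongr
        exact (le_abs_self _).trans (hC x hx)
      · simp [hR x hx]
  -- Each step divides the scale by `√2`: the factor `2 ^ k` from iterated doubling is exactly `(h /
  -- ε k) ^ 2`.
  set ε : ℕ → ℝ := fun k => h / √2 ^ k with hεdef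
  have h1 : (1 : ℝ) < √2 := by rw [Real.lt_sqrt] <;> norm_num
  have hε : ∀ k, 0 < ε k := fun k => by positivity
  have hεh : ∀ k, ε k ≤ h := fun k => div_le_self hh.le (one_le_pow₀ h1.le)
  have hε0 : Tendsto ε atTop (𝓝 0) := by
    have := (tendsto_pow_atTop_atTop_of_one_lt h1).const_div_atTop h
    exact this
  set k1 : E → ENNReal := fun z => ENNReal.ofReal (gaussKernel 1 z) with hk1
  have hk : Measurable k1 := by fun_prop
  have hlim : Tendsto (fun k => ∫⁻ z, k1 z
        * ∫⁻ x, ENNReal.ofReal (((g (x + ε k • z) - g x) / ε k) ^ 2)) atTop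
      (𝓝 (∫⁻ z, k1 z * ∫⁻ x, ENNReal.ofReal (fderiv ℝ g x z ^ 2))) := by
    refine tendsto_lintegral_of_dominated_convergence
      (fun z => k1 z * (ENNReal.ofReal ((L * ‖z‖) ^ 2) * (2 * volume B))) (fun k => ?_)
      (fun k => .of_forall fun z => ?_) ?_ (.of_forall fun z => ?_)
    · exact hk.mul (Measurable.lintegral_prod_right' (f := fun p : E × E =>
        ENNReal.ofReal (((g (p.2 + ε k • p.1) - g p.2) / ε k) ^ 2)) (by fun_prop))
    · exact mul_le_mul_right (lintegral_sq_increment_le hg hR (hε k) z) _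
    · have e : ∀ z : E, k1 z * (ENNReal.ofReal ((L * ‖z‖) ^ 2) * (2 * volume B))
          = ENNReal.ofReal (‖z‖ ^ 2 * gaussKernel 1 z)
            * (ENNReal.ofReal (L ^ 2) * (2 * volume B)) := by
        intro z
        rw [mul_pow, ENNReal.ofReal_mul (by positivity), ENNReal.ofReal_mul (by positivity)]
        ring
      simp_rw [e]
      rw [lintegral_mul_const _ (by fun_prop)]
      refine ENNReal.mul_ne_top ?_ (ENNReal.mul_ne_top ENNReal.ofReal_ne_top
        (ENNReal.mul_ne_top (by norm_num) hBt))
      exact (integrable_sq_norm_mul_gaussKernel (E := E)).lintegral_lt_top.ne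
    · exact ENNReal.Tendsto.const_mul (tendsto_lintegral_sq_increment hg hR hε hεh hε0 z)
        (.inr ENNReal.ofReal_ne_top)
  have hle : ∀ k, gaussEnergy h g ≤ ENNReal.ofReal (h ^ 2) * ∫⁻ z, k1 z
        * ∫⁻ x, ENNReal.ofReal (((g (x + ε k • z) - g x) / ε k) ^ 2) := by
    intro k
    refine (gaussEnergy_le_two_pow_mul hh hgm hg0 hg2 k).trans_eq ?_
    rw [gaussEnergy_eq_rescale (hε k), ← mul_assoc]
    congr 1
    rw [← ENNReal.ofReal_ofNat 2, ← ENNReal.ofReal_pow (by norm_num),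
      ← ENNReal.ofReal_mul (by positivity)]
    congr 1
    have : (√2 ^ k) ^ 2 = 2 ^ k := by
      rw [← pow_mul, mul_comm, pow_mul, Real.sq_sqrt (by norm_num)]
    rw [hεdef]
    simp only [div_pow, this]
    field_simp
  have hA := ge_of_tendsto' (ENNReal.Tendsto.const_mul hlim (.inr ENNReal.ofReal_ne_top)) hle
  refine hA.trans ?_
  have hfm := measurable_fderiv_apply_prod g
  -- Integrating over `z` first replaces `(∇g · z)²` by its Gaussian mean `‖∇g‖²`.
  have hsw : ∫⁻ z, k1 z * ∫⁻ x, ENNReal.ofReal (fderiv ℝ g x z ^ 2)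
      = ∫⁻ x, ENNReal.ofReal (‖fderiv ℝ g x‖ ^ 2) := by
    simp_rw [← lintegral_clm_sq_mul_gaussKernel]
    rw [lintegral_lintegral_swap]
    · refine lintegral_congr fun z => ?_
      rw [← lintegral_const_mul' _ _ ENNReal.ofReal_ne_top]
    · exact ((hk.comp measurable_snd).mul (hfm.pow_const 2).ennreal_ofReal).aemeasurable
  rw [hsw, mul_pow, ENNReal.ofReal_mul (sq_nonneg _), mul_assoc]
  gcongr
  exact lintegral_sq_norm_fderiv_le hg hg0 hs hgs

theorem LipschitzWith.setLIntegral_gaussIncrement_le {L : NNReal} {g : E → ℝ}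
    (hg : LipschitzWith L g)
    (hg0 : ∀ x, 0 ≤ g x) {s : Set E} (hs : MeasurableSet s) (hgs : ∀ᵐ x, x ∉ s → g x = 0) {R : ℝ}
    (hR : ∀ x ∉ Metric.closedBall (0 : E) R, g x = 0) {h : ℝ} (hh : 0 < h) (hL : 0 < L) :
    ∫⁻ x in s, ∫⁻ y, ENNReal.ofReal (gaussKernel h y) * ENNReal.ofReal |g (x + y) - g x|
      ≤ ENNReal.ofReal (h * L) * volume s := by
  have hgm : Measurable g := hg.continuous.measurable
  have hL' : (0 : ℝ) < L := hL
  set k : E → ENNReal := fun y => ENNReal.ofReal (gaussKernel h y) with hkdef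
  have hk : Measurable k := by fun_prop
  -- The weight that balances `|t| ≤ c / 2 + t² / (2c)`: after integration both terms equal `h * L /
  -- 2` times the volume.
  set c : ℝ := h * L with hc
  have hc0 : 0 < c := by positivity
  have hamgm : ∀ t : ℝ, ENNReal.ofReal |t|
      ≤ ENNReal.ofReal (c / 2) + ENNReal.ofReal (1 / (2 * c)) * ENNReal.ofReal (t ^ 2) := by
    intro t
    rw [← ENNReal.ofReal_mul (by positivity), ← ENNReal.ofReal_add (by positivity) (by positivity)]
    refine ENNReal.ofReal_le_ofReal ?_
    have : c / 2 + 1 / (2 * c) * t ^ 2 - |t| = 1 / (2 * c) * (c - |t|) ^ 2 := by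
      rw [← sq_abs t]; field_simp; ring
    have h2 : 0 ≤ 1 / (2 * c) * (c - |t|) ^ 2 := by positivity
    linarith
  calc ∫⁻ x in s, ∫⁻ y, k y * ENNReal.ofReal |g (x + y) - g x|
      ≤ ∫⁻ x in s, ∫⁻ y, (k y * ENNReal.ofReal (c / 2)
          + ENNReal.ofReal (1 / (2 * c)) * (k y * ENNReal.ofReal ((g (x + y) - g x) ^ 2))) := by
        refine lintegral_mono fun x => lintegral_mono fun y => ?_
        refine (mul_le_mul_right (hamgm _) (k y)).trans_eq ?_
        ring
    _ = ∫⁻ x in s, (ENNReal.ofReal (c / 2) + ENNReal.ofReal (1 / (2 * c))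
          * ∫⁻ y, (k y * ENNReal.ofReal ((g (x + y) - g x) ^ 2))) := by
        refine lintegral_congr fun x => ?_
        rw [lintegral_add_left (by fun_prop), lintegral_mul_const _ hk, lintegral_gaussKernel hh,
          one_mul, lintegral_const_mul _ (by fun_prop)]
    _ = ENNReal.ofReal (c / 2) * volume s + ENNReal.ofReal (1 / (2 * c))
          * ∫⁻ x in s, ∫⁻ y, (k y * ENNReal.ofReal ((g (x + y) - g x) ^ 2)) := by
        rw [lintegral_add_left (by fun_prop), setLIntegral_const,
          lintegral_const_mul' _ _ ENNReal.ofReal_ne_top]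
    _ ≤ ENNReal.ofReal (c / 2) * volume s + ENNReal.ofReal (1 / (2 * c))
          * (ENNReal.ofReal (c ^ 2) * volume s) := by
        gcongr
        refine (setLIntegral_le_lintegral _ _).trans ?_
        rw [lintegral_lintegral_swap (Measurable.aemeasurable (by fun_prop))]
        refine le_trans (le_of_eq ?_) (hg.gaussEnergy_le hg0 hs hgs hR hh)
        refine lintegral_congr fun y => ?_
        rw [lintegral_const_mul' _ _ ENNReal.ofReal_ne_top]
    _ = ENNReal.ofReal c * volume s := by
        rw [← mul_assoc, ← add_mul, ← ENNReal.ofReal_mul (by positivity),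
          ← ENNReal.ofReal_add (by positivity) (by positivity)]
        congr 2
        field_simp
        ring

end GradientBound

/-! ### Bias of Gaussian smoothing for Hölder functions. -/

section HolderBias

open Module Filter Topology

variable {E : Type*} [NormedAddCommGroup E]

theorem continuous_of_abs_sub_le_mul_rpow {f : E → ℝ} {α C : ℝ} (hα : 0 < α)
    (hf : ∀ x y, |f x - f y| ≤ C * ‖x - y‖ ^ α) : Continuous f := by
  refine continuous_iff_continuousAt.2 fun y => ?_
  rw [ContinuousAt, tendsto_iff_dist_tendsto_zero]
  have h : Tendsto (fun x => C * ‖x - y‖ ^ α) (𝓝 y) (𝓝 (C * ‖y - y‖ ^ α)) :=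
    (((continuous_id.sub continuous_const).norm.rpow_const fun _ => .inr hα.le).const_mul
      C).tendsto y
  rw [sub_self, norm_zero, Real.zero_rpow hα.ne', mul_zero] at h
  exact squeeze_zero (fun _ => dist_nonneg) (fun x => hf x y) h

/-- A nonnegative Hölder function is uniformly close to its Lipschitz lower envelope. -/
theorem exists_lipschitzWith_le_of_holder {f : E → ℝ} (hf0 : ∀ x, 0 ≤ f x) {α C h : ℝ}
    (hα0 : 0 < α) (hα1 : α ≤ 1) (hC : 0 < C) (hf : ∀ x y, |f x - f y| ≤ C * ‖x - y‖ ^ α)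
    (hh : 0 < h) :
    ∃ g : E → ℝ, LipschitzWith (Real.toNNReal (α * C * h ^ (α - 1))) g ∧ (∀ x, 0 ≤ g x) ∧
      (∀ x, g x ≤ f x) ∧ ∀ x, f x - g x ≤ (1 - α) * C * h ^ α := by
  set L : ℝ := α * C * h ^ (α - 1) with hLdef
  have hL : 0 < L := by positivity
  have hbdd : ∀ x, BddBelow (Set.range fun y => f y + L * ‖x - y‖) := fun x =>
    ⟨0, by rintro _ ⟨y, rfl⟩; have := hf0 y; positivity⟩
  -- Infimal convolution with the cone of slope `L`.
  refine ⟨fun x => ⨅ y, f y + L * ‖x - y‖, ?_, fun x => ?_, fun x => ?_, fun x => ?_⟩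
  · refine LipschitzWith.of_le_add_mul _ fun x x' => ?_
    rw [Real.coe_toNNReal _ hL.le, ← sub_le_iff_le_add]
    refine le_ciInf fun y => ?_
    rw [sub_le_iff_le_add]
    refine (ciInf_le (hbdd x) y).trans ?_
    have : ‖x - y‖ ≤ ‖x' - y‖ + dist x x' := by
      rw [dist_eq_norm]
      calc ‖x - y‖ = ‖(x' - y) + (x - x')‖ := by congr 1; abel
        _ ≤ _ := norm_add_le _ _
    nlinarith
  · exact le_ciInf fun y => by have := hf0 y; positivity
  · exact (ciInf_le (hbdd x) x).trans_eq (by simp)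
  · rw [sub_le_comm]
    refine le_ciInf fun y => ?_
    have h1 : f x - f y ≤ C * ‖x - y‖ ^ α := (le_abs_self _).trans (hf x y)
    -- Tangent line to the concave function `t ^ α` at `t = h`. After multiplication by `C` its
    -- slope is `L` and its intercept the claimed gap, which explains the choice of `L`.
    have h2 : ‖x - y‖ ^ α ≤ h ^ α * (1 + α * (‖x - y‖ / h - 1)) := by
      have h3 := rpow_one_add_le_one_add_mul_self
        (by have : 0 ≤ ‖x - y‖ / h := by positivity
            linarith : -1 ≤ ‖x - y‖ / h - 1) hα0.le hα1
      rw [add_sub_cancel] at h3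
      calc ‖x - y‖ ^ α = h ^ α * (‖x - y‖ / h) ^ α := by
            rw [← Real.mul_rpow hh.le (by positivity), mul_div_cancel₀ _ hh.ne']
        _ ≤ _ := by gcongr
    have h4 : C * (h ^ α * (1 + α * (‖x - y‖ / h - 1)))
        = (1 - α) * C * h ^ α + L * ‖x - y‖ := by
      rw [hLdef, Real.rpow_sub_one hh.ne']; field_simp; ring
    have h5 := mul_le_mul_of_nonneg_left h2 hC.le
    linarith

variable [InnerProductSpace ℝ E] [FiniteDimensional ℝ E] [MeasurableSpace E] [BorelSpace E]

/-- The mean bias of Gaussian smoothing of a Hölder function, with a dimension-free constant. -/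
theorem setLIntegral_abs_sub_gaussAverage_le {f : E → ℝ} (hf0 : ∀ x, 0 ≤ f x)
    (hfb : BddAbove (Set.range f)) {α C h : ℝ}
    (hα0 : 0 < α) (hα1 : α ≤ 1) (hC : 0 < C) (hf : ∀ x y, |f x - f y| ≤ C * ‖x - y‖ ^ α)
    (hh : 0 < h) {s : Set E} (hs : MeasurableSet s) (hsb : Bornology.IsBounded s)
    (hfs : ∀ᵐ x, x ∉ s → f x = 0) :
    ∫⁻ x in s, ENNReal.ofReal |f x - ∫ y, gaussKernel h y * f (x + y)|
      ≤ ENNReal.ofReal (C * h ^ α) * volume s := by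
  have hfc := continuous_of_abs_sub_le_mul_rpow hα0 hf
  obtain ⟨g, hgL, hg0, hgf, hfg⟩ := exists_lipschitzWith_le_of_holder hf0 hα0 hα1 hC hf hh
  obtain ⟨M, hM⟩ := hfb
  obtain ⟨R, hR⟩ := hsb.subset_closedBall 0
  have hgc := hgL.continuous
  have hgs : ∀ᵐ x, x ∉ s → g x = 0 := by
    filter_upwards [hfs] with x hx hxs
    exact le_antisymm ((hgf x).trans_eq (hx hxs)) (hg0 x)
  -- The complement of the ball is open, so continuity upgrades almost everywhere zero to zero.
  have hgR : ∀ x ∉ Metric.closedBall (0 : E) R, g x = 0 := by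
    have : Set.EqOn g 0 (Metric.closedBall (0 : E) R)ᶜ := by
      refine Measure.eqOn_open_of_ae_eq (μ := (volume : Measure E)) ?_
        Metric.isClosed_closedBall.isOpen_compl hgc.continuousOn continuousOn_const
      rw [Filter.EventuallyEq, ae_restrict_iff' Metric.isClosed_closedBall.measurableSet.compl]
      filter_upwards [hgs] with x hx hxR using hx fun hxs => hxR (hR hxs)
    exact fun x hx => this hx
  set L : ℝ := α * C * h ^ (α - 1) with hLdef
  have hL : 0 < L := by positivity
  set m : ℝ := (1 - α) * C * h ^ α with hm
  have hm0 : 0 ≤ m := by have : 0 ≤ 1 - α := by linarith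
                         positivity
  set k : E → ℝ := gaussKernel h
  have hk0 : ∀ y, 0 ≤ k y := gaussKernel_nonneg hh.le
  have hki : Integrable k := integrable_gaussKernel hh
  -- Since `f - g` takes values in `[0, m]`, the increments of `f` and `g` differ by at most `m`; a
  -- two-sided approximation would cost `2 * m`.
  have hpt : ∀ x, ENNReal.ofReal |f x - ∫ y, k y * f (x + y)|
      ≤ (∫⁻ y, ENNReal.ofReal (k y) * ENNReal.ofReal |g (x + y) - g x|) + ENNReal.ofReal m := by
    intro x
    have hi : Integrable fun y => k y * f (x + y) :=
      hki.mul_bdd (c := M) (Continuous.aestronglyMeasurable (by fun_prop)) (.of_forall fun y => by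
        rw [Real.norm_of_nonneg (hf0 _)]; exact hM ⟨_, rfl⟩)
    have e : f x - ∫ y, k y * f (x + y) = ∫ y, k y * (f x - f (x + y)) := by
      simp_rw [mul_sub]
      rw [integral_sub (hki.mul_const _) hi, integral_mul_const, integral_gaussKernel hh, one_mul]
    rw [e]
    rw [← Real.enorm_eq_ofReal_abs]
    refine (enorm_integral_le_lintegral_enorm _).trans ?_
    have hmk : ENNReal.ofReal m = ∫⁻ y, ENNReal.ofReal (k y) * ENNReal.ofReal m := by
      rw [lintegral_mul_const _ (by fun_prop), lintegral_gaussKernel hh, one_mul]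
    rw [hmk, ← lintegral_add_right _ (by fun_prop)]
    refine lintegral_mono fun y => ?_
    rw [Real.enorm_eq_ofReal_abs, abs_mul, abs_of_nonneg (hk0 y), ENNReal.ofReal_mul (hk0 y),
      ← mul_add, ← ENNReal.ofReal_add (abs_nonneg _) hm0]
    gcongr
    have h1 := hgf x
    have h2 := hfg x
    have h3 := hgf (x + y)
    have h4 := hfg (x + y)
    rw [abs_sub_comm (g (x + y))]
    rw [abs_le]
    constructor
    · linarith [neg_abs_le (g x - g (x + y))]
    · linarith [le_abs_self (g x - g (x + y))]
  calc _ ≤ ∫⁻ x in s, ((∫⁻ y, ENNReal.ofReal (k y) * ENNReal.ofReal |g (x + y) - g x|)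
          + ENNReal.ofReal m) := lintegral_mono hpt
    _ ≤ ENNReal.ofReal (h * L) * volume s + ENNReal.ofReal m * volume s := by
        rw [lintegral_add_right _ measurable_const, setLIntegral_const]
        gcongr
        have := hgL.setLIntegral_gaussIncrement_le hg0 hs hgs hgR hh (Real.toNNReal_pos.2 hL)
        rwa [Real.coe_toNNReal _ hL.le] at this
    _ = _ := by
        rw [← add_mul, ← ENNReal.ofReal_add (by positivity) hm0]
        congr 2
        rw [hLdef, hm, Real.rpow_sub_one hh.ne']; field_simp; ring

end HolderBias

/-! ### Hoeffding's lemma and McDiarmid's inequality. -/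

section BoundedDifferences

variable {𝓧 : Type*} [MeasurableSpace 𝓧] {μ : Measure 𝓧} [IsProbabilityMeasure μ]

theorem integral_exp_mul_le_of_mem_Icc {G : 𝓧 → ℝ} (hG : Measurable G) {a : ℝ} {c : NNReal}
    (hGa : ∀ x, G x ∈ Set.Icc a (a + c)) (t : ℝ) :
    ∫ x, Real.exp (t * G x) ∂μ ≤ Real.exp (t * ∫ x, G x ∂μ + (c / 2) ^ 2 * t ^ 2 / 2) := by
  have h := (hasSubgaussianMGF_of_mem_Icc (μ := μ) hG.aemeasurable (.of_forall hGa)).mgf_le t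
  have e : ‖a + (c : ℝ) - a‖₊ = c := by ext; simp
  rw [e, mgf] at h
  push_cast at h
  simp_rw [mul_sub, sub_eq_add_neg, Real.exp_add] at h
  rw [integral_mul_const, Real.exp_neg, ← div_eq_mul_inv, div_le_iff₀ (Real.exp_pos _),
    ← Real.exp_add] at h
  rwa [add_comm]

/-- Split off coordinate `0`. With it fixed, the induction hypothesis handles the others; their
average `G` depends on it with oscillation at most `c`, so Hoeffding's lemma applies. The bound `M`
enters only through integrability. -/
theorem integral_exp_mul_le_of_boundedDifferences {c : NNReal} {M : ℝ} (n : ℕ)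
    {F : (Fin n → 𝓧) → ℝ} (hF : Measurable F) (hFM : ∀ x, F x ∈ Set.Icc 0 M)
    (hFc : ∀ x i y, F x ≤ F (Function.update x i y) + c) (t : ℝ) :
    ∫ x, Real.exp (t * F x) ∂(Measure.pi fun _ => μ)
      ≤ Real.exp (t * (∫ x, F x ∂(Measure.pi fun _ => μ)) + n * (c / 2) ^ 2 * t ^ 2 / 2) := by
  induction n with
  | zero => simp [Measure.pi_of_empty (fun _ : Fin 0 => μ)]
  | succ n ih =>
    have : Nonempty 𝓧 := nonempty_of_isProbabilityMeasure μ
    have hmp := (measurePreserving_piFinSuccAbove (fun _ : Fin (n + 1) => μ) 0).symm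
    set e := (MeasurableEquiv.piFinSuccAbove (fun _ : Fin (n + 1) => 𝓧) 0).symm with he
    have hem : Measurable e := e.measurable
    have hFe : Measurable fun p : 𝓧 × (Fin n → 𝓧) => F (e p) := hF.comp hem
    set ν : Measure (Fin n → 𝓧) := Measure.pi fun _ => μ with hν
    have hup : ∀ a b : 𝓧, ∀ r, e (a, r) = Function.update (e (b, r)) 0 a := by
      intro a b r
      simp [he, MeasurableEquiv.piFinSuccAbove, Fin.insertNthEquiv]
    have hup' : ∀ (a : 𝓧) r i y, e (a, Function.update r i y)
        = Function.update (e (a, r)) i.succ y := by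
      intro a r i y
      simp [he, MeasurableEquiv.piFinSuccAbove, Fin.insertNthEquiv, Fin.cons_update]
    have hbd : ∀ {Y : Type _} [MeasurableSpace Y] (ρ : Measure Y) [IsProbabilityMeasure ρ]
        (φ : Y → ℝ), Measurable φ → (∀ y, φ y ∈ Set.Icc 0 M) → Integrable φ ρ :=
      fun ρ _ φ hφ hb => Integrable.of_mem_Icc 0 M hφ.aemeasurable (.of_forall hb)
    have hbe : ∀ {Y : Type _} [MeasurableSpace Y] (ρ : Measure Y) [IsProbabilityMeasure ρ]
        (φ : Y → ℝ), Measurable φ → (∀ y, φ y ∈ Set.Icc 0 M) →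
          Integrable (fun y => Real.exp (t * φ y)) ρ :=
      fun ρ _ φ hφ hb => integrable_exp_mul_of_mem_Icc hφ.aemeasurable (.of_forall hb)
    set G : 𝓧 → ℝ := fun a => ∫ r, F (e (a, r)) ∂ν with hGdef
    have hGm : Measurable G := by
      have : StronglyMeasurable G := StronglyMeasurable.integral_prod_right'
        (f := fun p : 𝓧 × (Fin n → 𝓧) => F (e p)) hFe.stronglyMeasurable
      exact this.measurable
    have hi : ∀ a, Integrable (fun r => F (e (a, r))) ν := fun a =>
      hbd ν _ (hFe.comp measurable_prodMk_left) fun r => hFM _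
    have hGc : ∀ a b, G a ≤ G b + c := by
      intro a b
      have : ∫ r, (F (e (b, r)) + c) ∂ν = G b + c := by
        rw [integral_add (hi b) (integrable_const _)]; simp [hGdef]
      rw [← this]
      refine integral_mono (hi a) ((hi b).add (integrable_const _)) fun r => ?_
      rw [hup b a]
      exact hFc _ _ _
    have hG0 : ∀ a, 0 ≤ G a := fun a => integral_nonneg fun r => (hFM _).1
    have hGI : ∀ a, G a ∈ Set.Icc (⨅ b, G b) ((⨅ b, G b) + c) := fun a =>
      ⟨ciInf_le ⟨0, by rintro _ ⟨b, rfl⟩; exact hG0 b⟩ a, by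
        rw [← sub_le_iff_le_add]
        exact le_ciInf fun b => sub_le_iff_le_add.2 (hGc a b)⟩
    have hFint : ∫ x, F x ∂(Measure.pi fun _ : Fin (n + 1) => μ) = ∫ a, G a ∂μ := by
      rw [← hmp.integral_comp', integral_prod]
      exact hbd _ _ hFe fun p => hFM _
    have hexp : ∫ x, Real.exp (t * F x) ∂(Measure.pi fun _ : Fin (n + 1) => μ)
        = ∫ a, ∫ r, Real.exp (t * F (e (a, r))) ∂ν ∂μ := by
      rw [← hmp.integral_comp', integral_prod]
      exact hbe _ _ hFe fun p => hFM _
    have hGM : ∀ a, G a ∈ Set.Icc 0 M := fun a => ⟨hG0 a, by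
      have := integral_mono (hi a) (integrable_const M) fun r => (hFM _).2
      simpa using this⟩
    rw [hexp, hFint]
    calc ∫ a, ∫ r, Real.exp (t * F (e (a, r))) ∂ν ∂μ
        ≤ ∫ a, Real.exp (t * G a) * Real.exp (n * (c / 2) ^ 2 * t ^ 2 / 2) ∂μ := by
          refine integral_mono (hbe (μ.prod ν) _ hFe fun p => hFM _).integral_prod_left
            ((hbe μ _ hGm hGM).mul_const _) fun a => ?_
          simp only [← Real.exp_add]
          exact ih (hFe.comp measurable_prodMk_left) (fun r => hFM _) fun r i y => by
            change F (e (a, r)) ≤ F (e (a, Function.update r i y)) + c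
            rw [hup']
            exact hFc _ _ _
      _ ≤ Real.exp (t * ∫ x, G x ∂μ + (c / 2) ^ 2 * t ^ 2 / 2)
            * Real.exp (n * (c / 2) ^ 2 * t ^ 2 / 2) := by
          rw [integral_mul_const]
          gcongr
          exact integral_exp_mul_le_of_mem_Icc hGm hGI t
      _ = _ := by
          rw [← Real.exp_add]; push_cast; ring_nf

/-- **McDiarmid's inequality** for independent identically distributed variables. -/
theorem measure_ge_le_of_boundedDifferences {c : NNReal} {M : ℝ} {n : ℕ}
    {F : (Fin n → 𝓧) → ℝ} (hF : Measurable F) (hFM : ∀ x, F x ∈ Set.Icc 0 M)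
    (hFc : ∀ x i y, F x ≤ F (Function.update x i y) + c) {ε : ℝ} (hε : 0 ≤ ε) :
    (Measure.pi fun _ => μ).real {x | (∫ x, F x ∂(Measure.pi fun _ => μ)) + ε ≤ F x}
      ≤ Real.exp (-ε ^ 2 / (2 * (n * (c / 2) ^ 2))) := by
  set ν : Measure (Fin n → 𝓧) := Measure.pi fun _ => μ with hν
  have hi : ∀ t : ℝ, Integrable (fun x => Real.exp (t * F x)) ν := fun t =>
    integrable_exp_mul_of_mem_Icc hF.aemeasurable (.of_forall hFM)
  have hs : HasSubgaussianMGF (fun x => F x - ∫ x, F x ∂ν) (n * (c / 2) ^ 2) ν := by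
    refine ⟨fun t => ?_, fun t => ?_⟩
    · simp_rw [mul_sub, sub_eq_add_neg, Real.exp_add]
      exact (hi t).mul_const _
    · simp only [mgf]
      simp_rw [mul_sub, sub_eq_add_neg, Real.exp_add]
      rw [integral_mul_const, Real.exp_neg, ← div_eq_mul_inv, div_le_iff₀ (Real.exp_pos _),
        ← Real.exp_add, add_comm]
      have := integral_exp_mul_le_of_boundedDifferences (μ := μ) n hF hFM hFc t
      push_cast
      exact this
  have := hs.measure_ge_le hε
  simp only [le_sub_iff_add_le'] at this
  push_cast at this
  exact this

end BoundedDifferences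

/-! ### Measurability in the parameter and range of the expected cost. -/

section MDPFamily

variable {S A : Type*} [MeasurableSpace S] [MeasurableSpace A] {Θ : Type*} [MeasurableSpace Θ]

/-- Treat the parameter as an input of two kernels; the family is then a single composition-product
kernel, measurable by construction. -/
theorem measurable_compProd_joint {X Y Z : Type*} [MeasurableSpace X] [MeasurableSpace Y]
    [MeasurableSpace Z] {ρ : X → Measure Y} {κ : X → Kernel Y Z}
    [∀ x, IsProbabilityMeasure (ρ x)] [∀ x, IsMarkovKernel (κ x)]
    (hρ : Measurable ρ) (hκ : Measurable fun p : X × Y => κ p.1 p.2) :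
    Measurable fun x => ρ x ⊗ₘ κ x := by
  let ρ' : Kernel X Y := ⟨ρ, hρ⟩
  let κ' : Kernel (X × Y) Z := ⟨fun p => κ p.1 p.2, hκ⟩
  have : IsMarkovKernel ρ' := ⟨fun x => inferInstanceAs (IsProbabilityMeasure (ρ x))⟩
  have : IsMarkovKernel κ' := ⟨fun p => inferInstanceAs (IsProbabilityMeasure (κ p.1 p.2))⟩
  have h : (fun x => ρ x ⊗ₘ κ x) = fun x => (ρ' ⊗ₖ κ') x := by
    funext x
    ext s hs
    rw [Measure.compProd_apply hs, Kernel.compProd_apply hs]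
    rfl
  rw [h]
  exact (ρ' ⊗ₖ κ').measurable

theorem measurable_prod_joint {X Y Z : Type*} [MeasurableSpace X] [MeasurableSpace Y]
    [MeasurableSpace Z] {ρ : X → Measure Y} {σ : X → Measure Z}
    [∀ x, IsProbabilityMeasure (ρ x)] [∀ x, IsProbabilityMeasure (σ x)]
    (hρ : Measurable ρ) (hσ : Measurable σ) :
    Measurable fun x => (ρ x).prod (σ x) := by
  let ρ' : Kernel X Y := ⟨ρ, hρ⟩
  let σ' : Kernel X Z := ⟨σ, hσ⟩
  have : IsMarkovKernel ρ' := ⟨fun x => inferInstanceAs (IsProbabilityMeasure (ρ x))⟩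
  have : IsMarkovKernel σ' := ⟨fun x => inferInstanceAs (IsProbabilityMeasure (σ x))⟩
  have h : (fun x => (ρ x).prod (σ x)) = fun x => (ρ' ×ₖ σ') x := by
    funext x
    rw [Kernel.prod_apply]
    rfl
  rw [h]
  exact (ρ' ×ₖ σ').measurable

namespace MDP

/-- Freezing the history leaves a measure composed with a kernel in the action alone, the form
needed for joint measurability and for null sets. -/
theorem stepKernel_apply (M : MDP S A) (π : Policy S A) (t : ℕ) (h : History S A t) :
    M.stepKernel π t h = π.act t h ⊗ₘ ((M.cost ×ₖ M.nextState t).comap (fun a => (h.2, a))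
      (by fun_prop)) := by
  ext s hs
  rw [stepKernel, Kernel.compProd_apply hs, Measure.compProd_apply hs]
  rfl

variable {g : Θ → MDP S A}

theorem measurable_nextState_joint (hinit : Measurable fun θ => (g θ).init)
    (htrans : Measurable fun p : Θ × S × A => (g p.1).trans p.2)
    (hhor : Measurable fun θ => (g θ).horizon) (t : ℕ) :
    Measurable fun p : Θ × S × A => (g p.1).nextState t p.2 := by
  have hd : MeasurableSet {p : Θ × S × A | (g p.1).horizon ∣ t + 1} :=
    (hhor.comp measurable_fst) (MeasurableSet.of_discrete (s := {k : ℕ | k ∣ t + 1}))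
  have e : (fun p : Θ × S × A => (g p.1).nextState t p.2)
      = {p : Θ × S × A | (g p.1).horizon ∣ t + 1}.piecewise
        (fun p => (g p.1).init) (fun p => (g p.1).trans p.2) := by
    classical
    funext p
    by_cases h : (g p.1).horizon ∣ t + 1 <;> simp [nextState, Set.piecewise, h]
  rw [e]
  exact Measurable.piecewise hd (hinit.comp measurable_fst) htrans

theorem measurable_historyLaw (hinit : Measurable fun θ => (g θ).init)
    (hcost : Measurable fun p : Θ × S × A => (g p.1).cost p.2)
    (htrans : Measurable fun p : Θ × S × A => (g p.1).trans p.2)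
    (hhor : Measurable fun θ => (g θ).horizon) (π : Policy S A) (t : ℕ) :
    Measurable fun θ => (g θ).historyLaw π t := by
  induction t with
  | zero => exact (Measure.measurable_map _ (by fun_prop)).comp hinit
  | succ t ih =>
    refine (Measure.measurable_map _ (measurable_extendHistory t)).comp ?_
    refine measurable_compProd_joint ih ?_
    simp_rw [stepKernel_apply]
    refine measurable_compProd_joint (X := Θ × History S A t)
      (ρ := fun p => π.act t p.2) ((π.act t).measurable.comp measurable_snd) ?_
    simp only [Kernel.comap_apply, Kernel.prod_apply]
    have hm : Measurable fun q : (Θ × History S A t) × A => (q.1.1, q.1.2.2, q.2) := by fun_prop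
    exact measurable_prod_joint (ρ := fun q : (Θ × History S A t) × A =>
        (g q.1.1).cost (q.1.2.2, q.2))
      (σ := fun q : (Θ × History S A t) × A => (g q.1.1).nextState t (q.1.2.2, q.2))
      (hcost.comp hm) ((measurable_nextState_joint hinit htrans hhor t).comp hm)

theorem measurable_cumulativeCost (T : ℕ) :
    Measurable fun h : History S A T => ∑ t : Fin T, (h.1 t).2.2 := by
  refine Finset.measurable_sum _ fun t _ => ?_
  exact (measurable_snd.comp measurable_snd).comp ((measurable_pi_apply t).comp measurable_fst)

theorem measurable_expectedCost (hinit : Measurable fun θ => (g θ).init)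
    (hcost : Measurable fun p : Θ × S × A => (g p.1).cost p.2)
    (htrans : Measurable fun p : Θ × S × A => (g p.1).trans p.2)
    (hhor : Measurable fun θ => (g θ).horizon) (π : Policy S A) (T : ℕ) :
    Measurable fun θ => (g θ).expectedCost π T := by
  let κ : Kernel Θ (History S A T) :=
    ⟨fun θ => (g θ).historyLaw π T, measurable_historyLaw hinit hcost htrans hhor π T⟩
  have : IsMarkovKernel κ :=
    ⟨fun θ => inferInstanceAs (IsProbabilityMeasure ((g θ).historyLaw π T))⟩
  exact ((measurable_cumulativeCost (S := S) (A := A) T).stronglyMeasurable.integral_kernel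
    (κ := κ)).measurable

theorem ae_historyLaw_cost_mem (M : MDP S A) (π : Policy S A) {C : ℝ}
    (hC : ∀ s a, ∀ᵐ c ∂(M.cost (s, a)), c ∈ Set.Icc 0 C) (T : ℕ) :
    ∀ᵐ h ∂(M.historyLaw π T), ∀ t : Fin T, (h.1 t).2.2 ∈ Set.Icc 0 C := by
  induction T with
  | zero => exact .of_forall fun h t => t.elim0
  | succ T ih =>
    have hms : ∀ n, MeasurableSet {h : History S A n | ∀ t : Fin n, (h.1 t).2.2 ∈ Set.Icc 0 C} := by
      intro n
      rw [Set.ofPred_forall]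
      refine MeasurableSet.iInter fun t => ?_
      have : Measurable fun h : History S A n => (h.1 t).2.2 :=
        (measurable_snd.comp measurable_snd).comp ((measurable_pi_apply t).comp measurable_fst)
      exact this measurableSet_Icc
    rw [historyLaw, ae_map_iff (measurable_extendHistory T).aemeasurable (hms _)]
    have hme : MeasurableSet {p : History S A T × A × ℝ × S |
        ∀ t, ((extendHistory T p).1 t).2.2 ∈ Set.Icc 0 C} := measurable_extendHistory T (hms _)
    rw [Measure.ae_compProd_iff hme]
    filter_upwards [ih] with h hh
    rw [stepKernel_apply, Measure.ae_compProd_iff]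
    · refine .of_forall fun a => ?_
      rw [Kernel.comap_apply, Kernel.prod_apply]
      have := (Measure.quasiMeasurePreserving_fst (μ := M.cost (h.2, a))
        (ν := M.nextState T (h.2, a))).ae (hC h.2 a)
      filter_upwards [this] with q hq t
      refine Fin.lastCases ?_ (fun j => ?_) t
      · simpa [extendHistory] using hq
      · simpa [extendHistory] using hh j
    · exact measurable_prodMk_left hme

theorem expectedCost_mem_Icc (M : MDP S A) (π : Policy S A) {C : ℝ}
    (hC : ∀ s a, ∀ᵐ c ∂(M.cost (s, a)), c ∈ Set.Icc 0 C) (T : ℕ) :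
    M.expectedCost π T ∈ Set.Icc 0 (T * C) := by
  have h := ae_historyLaw_cost_mem M π hC T
  have h1 : ∀ᵐ h ∂(M.historyLaw π T), ∑ t : Fin T, (h.1 t).2.2 ∈ Set.Icc 0 (T * C) := by
    filter_upwards [h] with h hh
    refine ⟨Finset.sum_nonneg fun t _ => (hh t).1, ?_⟩
    calc _ ≤ ∑ _t : Fin T, C := Finset.sum_le_sum fun t _ => (hh t).2
      _ = _ := by simp
  have hi : Integrable (fun h : History S A T => ∑ t : Fin T, (h.1 t).2.2) (M.historyLaw π T) :=
    Integrable.of_mem_Icc 0 (T * C) (measurable_cumulativeCost T).aemeasurable h1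
  refine ⟨integral_nonneg_of_ae (h1.mono fun _ h => h.1), ?_⟩
  have := integral_mono_ae hi (integrable_const (T * C)) (h1.mono fun _ h => h.2)
  simpa [expectedCost] using this

end MDP

end MDPFamily

/-! ### Mean and concentration of the `L¹` deviation. -/

section Deviation

theorem integral_abs_sub_integral_le_sqrt_variance {Ω : Type*} [MeasurableSpace Ω] {μ : Measure Ω}
    [IsProbabilityMeasure μ] {Y : Ω → ℝ} (hY : MemLp Y 2 μ) :
    ∫ ω, |Y ω - ∫ ω, Y ω ∂μ| ∂μ ≤ √(variance Y μ) := by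
  have h1 : MemLp (fun ω => |Y ω - ∫ ω, Y ω ∂μ|) 2 μ := (hY.sub (memLp_const _)).abs
  -- Nonnegative variance of `|Y - EY|` is the inequality `(E|Y - EY|)² ≤ Var Y`.
  have h2 := variance_nonneg (fun ω => |Y ω - ∫ ω, Y ω ∂μ|) μ
  rw [variance_eq_sub h1, sub_nonneg] at h2
  refine Real.le_sqrt_of_sq_le (h2.trans_eq ?_)
  rw [variance_eq_integral hY.aestronglyMeasurable.aemeasurable]
  simp

open Module

variable {E : Type*} [NormedAddCommGroup E] [InnerProductSpace ℝ E]

/-- The Gaussian kernel density estimate on an arbitrary Euclidean space. -/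
noncomputable def gaussEstimate (h : ℝ) {n : ℕ} (X : Fin n → E) (x : E) : ℝ :=
  1 / n * ∑ i, gaussKernel h (x - X i)

theorem gaussEstimate_mem_Icc {h : ℝ} {n : ℕ} (hh : 0 < h) (hn : n ≠ 0) (X : Fin n → E) (x : E) :
    gaussEstimate h X x ∈ Set.Icc 0 (1 / (h * √(2 * Real.pi)) ^ finrank ℝ E) := by
  have hn' : (n : ℝ) ≠ 0 := by exact_mod_cast hn
  refine ⟨mul_nonneg (by positivity) (Finset.sum_nonneg fun i _ => gaussKernel_nonneg hh.le _), ?_⟩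
  calc gaussEstimate h X x
      ≤ 1 / n * ∑ _i : Fin n, 1 / (h * √(2 * Real.pi)) ^ finrank ℝ E := by
        unfold gaussEstimate
        gcongr with i
        exact gaussKernel_le hh.le _
    _ = _ := by simp; field_simp

variable [MeasurableSpace E] [BorelSpace E]

theorem memLp_gaussKernel_sub {μ : Measure E} [IsProbabilityMeasure μ] {h : ℝ} (hh : 0 < h)
    (x : E) :
    MemLp (fun u => gaussKernel h (x - u)) 2 μ := by
  have hkm : Measurable fun u : E => gaussKernel h (x - u) := by fun_prop
  exact MemLp.of_bound hkm.aestronglyMeasurable (1 / (h * √(2 * Real.pi)) ^ finrank ℝ E)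
    (.of_forall fun u => by
      rw [Real.norm_of_nonneg (gaussKernel_nonneg hh.le _)]; exact gaussKernel_le hh.le _)

theorem variance_gaussEstimate {μ : Measure E} [IsProbabilityMeasure μ] {h : ℝ} {n : ℕ}
    (hh : 0 < h) (x : E) :
    variance (fun X : Fin n → E => gaussEstimate h X x) (Measure.pi fun _ => μ)
      = (1 / n) ^ 2 * (n * variance (fun u => gaussKernel h (x - u)) μ) := by
  have h1 := variance_sum_pi (μ := fun _ : Fin n => μ) (X := fun _ u => gaussKernel h (x - u))
    fun _ => memLp_gaussKernel_sub hh x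
  have h2 : (∑ i : Fin n, fun X : Fin n → E => gaussKernel h (x - X i))
      = fun X => ∑ i, gaussKernel h (x - X i) := by
    funext X; rw [Finset.sum_apply]
  rw [h2, Finset.sum_const, Finset.card_univ, Fintype.card_fin, nsmul_eq_mul] at h1
  unfold gaussEstimate
  rw [variance_const_mul, h1]

variable [FiniteDimensional ℝ E]

/-- The Gaussian smoothing of `f` at scale `h`. -/
noncomputable def gaussSmooth (h : ℝ) (f : E → ℝ) (x : E) : ℝ := ∫ y, gaussKernel h y * f (x + y)

/-- The `L¹` distance on `s` between the kernel density estimate and its mean. -/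
noncomputable def gaussDeviation (h : ℝ) (f : E → ℝ) (s : Set E) {n : ℕ} (X : Fin n → E) : ℝ :=
  ∫ x in s, |gaussEstimate h X x - gaussSmooth h f x|

theorem integral_gaussKernel_sub_eq_gaussSmooth {f : E → ℝ} (hf : Measurable f)
    (hf0 : ∀ x, 0 ≤ f x) (h : ℝ) (x : E) :
    ∫ u, gaussKernel h (x - u) ∂(volume.withDensity fun x => ENNReal.ofReal (f x))
      = gaussSmooth h f x := by
  rw [integral_withDensity_eq_integral_toReal_smul hf.ennreal_ofReal
    (.of_forall fun _ => ENNReal.ofReal_lt_top), gaussSmooth,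
    ← integral_add_left_eq_self _ x]
  refine integral_congr_ae (.of_forall fun y => ?_)
  simp only [sub_add_cancel_left, gaussKernel_neg, smul_eq_mul, ENNReal.toReal_ofReal (hf0 _)]
  ring

theorem measurable_gaussSmooth (h : ℝ) {f : E → ℝ} (hf : Measurable f) :
    Measurable (gaussSmooth h f) := by
  have : StronglyMeasurable (gaussSmooth h f) := StronglyMeasurable.integral_prod_right'
    (f := fun p : E × E => gaussKernel h p.2 * f (p.1 + p.2))
    (Measurable.stronglyMeasurable (by fun_prop))
  exact this.measurable

theorem measurable_gaussEstimate (h : ℝ) (n : ℕ) :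
    Measurable fun p : (Fin n → E) × E => gaussEstimate h p.1 p.2 := by
  unfold gaussEstimate
  fun_prop

variable {f : E → ℝ} {μ : Measure E} {h : ℝ} {s : Set E} {n : ℕ}

/-- The squared kernel is a multiple of the kernel at scale `h / √2`, which has mass one; hence the
`4π`. -/
theorem integral_gaussKernel_sq_le (hf : Measurable f) (hf0 : ∀ x, 0 ≤ f x)
    (hμ : μ = volume.withDensity fun x => ENNReal.ofReal (f x)) (hh : 0 < h)
    {M : ℝ} (hM : ∀ᵐ x, f x ≤ M) (x : E) :
    ∫ u, gaussKernel h (x - u) ^ 2 ∂μ ≤ M / (h * √(4 * Real.pi)) ^ finrank ℝ E := by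
  rw [hμ, integral_withDensity_eq_integral_toReal_smul hf.ennreal_ofReal
    (.of_forall fun _ => ENNReal.ofReal_lt_top)]
  have hi : Integrable fun u => gaussKernel h (x - u) ^ 2 := by
    simp_rw [gaussKernel_sq hh]
    exact ((integrable_gaussKernel (by positivity)).comp_sub_left x).const_mul _
  calc ∫ u, (ENNReal.ofReal (f u)).toReal • gaussKernel h (x - u) ^ 2
      ≤ ∫ u, M * gaussKernel h (x - u) ^ 2 := by
        refine integral_mono_of_nonneg (.of_forall fun u => ?_) (hi.const_mul M) ?_
        · simp only [Pi.zero_apply, smul_eq_mul]; positivity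
        · filter_upwards [hM] with u hu
          simp only [ENNReal.toReal_ofReal (hf0 _), smul_eq_mul]
          gcongr
    _ = _ := by
        simp_rw [integral_const_mul, gaussKernel_sq hh]
        rw [integral_const_mul, integral_sub_left_eq_self (gaussKernel (h / √2)),
          integral_gaussKernel (by positivity)]
        ring

variable [IsProbabilityMeasure μ]

theorem gaussSmooth_mem_Icc (hf : Measurable f) (hf0 : ∀ x, 0 ≤ f x)
    (hμ : μ = volume.withDensity fun x => ENNReal.ofReal (f x)) (hh : 0 < h) (x : E) :
    gaussSmooth h f x ∈ Set.Icc 0 (1 / (h * √(2 * Real.pi)) ^ finrank ℝ E) := by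
  rw [← integral_gaussKernel_sub_eq_gaussSmooth hf hf0, ← hμ]
  refine ⟨integral_nonneg fun u => gaussKernel_nonneg hh.le _, ?_⟩
  have hi : Integrable (fun u => gaussKernel h (x - u)) μ :=
    Integrable.of_mem_Icc 0 (1 / (h * √(2 * Real.pi)) ^ finrank ℝ E)
      (Measurable.aemeasurable (by fun_prop))
      (.of_forall fun u => ⟨gaussKernel_nonneg hh.le _, gaussKernel_le hh.le _⟩)
  have := integral_mono hi (integrable_const _) fun u => gaussKernel_le hh.le (x - u)
  simpa using this

theorem abs_gaussEstimate_sub_le (hf : Measurable f) (hf0 : ∀ x, 0 ≤ f x)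
    (hμ : μ = volume.withDensity fun x => ENNReal.ofReal (f x)) (hh : 0 < h) (hn : n ≠ 0)
    (X : Fin n → E) (x : E) :
    |gaussEstimate h X x - gaussSmooth h f x| ≤ 1 / (h * √(2 * Real.pi)) ^ finrank ℝ E := by
  have h1 := gaussEstimate_mem_Icc hh hn X x
  have h2 := gaussSmooth_mem_Icc hf hf0 hμ hh x
  rw [abs_le]
  constructor <;> linarith [h1.1, h1.2, h2.1, h2.2]

theorem integrableOn_abs_gaussEstimate_sub (hf : Measurable f) (hf0 : ∀ x, 0 ≤ f x)
    (hμ : μ = volume.withDensity fun x => ENNReal.ofReal (f x)) (hh : 0 < h) (hn : n ≠ 0)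
    (hs : volume s ≠ ⊤) (X : Fin n → E) :
    IntegrableOn (fun x => |gaussEstimate h X x - gaussSmooth h f x|) s := by
  have : IsFiniteMeasure (volume.restrict s) := ⟨by simpa using hs.lt_top⟩
  refine Integrable.of_mem_Icc 0 (1 / (h * √(2 * Real.pi)) ^ finrank ℝ E) ?_
    (.of_forall fun x => ⟨abs_nonneg _, abs_gaussEstimate_sub_le hf hf0 hμ hh hn X x⟩)
  have := (measurable_gaussEstimate (E := E) h n).comp (measurable_prodMk_left (x := X))
  exact (this.sub (measurable_gaussSmooth h hf)).abs.aemeasurable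

theorem measurable_gaussDeviation (hf : Measurable f) (h : ℝ) (s : Set E) (n : ℕ) :
    Measurable fun X : Fin n → E => gaussDeviation h f s X := by
  have : StronglyMeasurable fun X : Fin n → E => gaussDeviation h f s X :=
    StronglyMeasurable.integral_prod_right' (ν := volume.restrict s)
      (f := fun p : (Fin n → E) × E => |gaussEstimate h p.1 p.2 - gaussSmooth h f p.2|)
      (((measurable_gaussEstimate h n).sub
        ((measurable_gaussSmooth h hf).comp measurable_snd)).abs.stronglyMeasurable)
  exact this.measurable

theorem gaussDeviation_mem_Icc (hf : Measurable f) (hf0 : ∀ x, 0 ≤ f x)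
    (hμ : μ = volume.withDensity fun x => ENNReal.ofReal (f x)) (hh : 0 < h) (hn : n ≠ 0)
    (hs : volume s ≠ ⊤) (X : Fin n → E) :
    gaussDeviation h f s X
      ∈ Set.Icc 0 (volume.real s * (1 / (h * √(2 * Real.pi)) ^ finrank ℝ E)) := by
  have : IsFiniteMeasure (volume.restrict s) := ⟨by simpa using hs.lt_top⟩
  refine ⟨integral_nonneg fun x => abs_nonneg _, ?_⟩
  have := integral_mono (integrableOn_abs_gaussEstimate_sub hf hf0 hμ hh hn hs X)
    (integrable_const (1 / (h * √(2 * Real.pi)) ^ finrank ℝ E))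
    (abs_gaussEstimate_sub_le hf hf0 hμ hh hn X)
  simpa [gaussDeviation] using this

/-- Replacing one sample swaps one bump for another, each of mass at most `1 / n` on `s`. -/
theorem gaussDeviation_le_update_add (hf : Measurable f) (hf0 : ∀ x, 0 ≤ f x)
    (hμ : μ = volume.withDensity fun x => ENNReal.ofReal (f x)) (hh : 0 < h) (hn : n ≠ 0)
    (hs : volume s ≠ ⊤) (X : Fin n → E) (i : Fin n) (y : E) :
    gaussDeviation h f s X ≤ gaussDeviation h f s (Function.update X i y) + 2 / n := by
  have hk : ∀ a : E, Integrable fun x => gaussKernel h (x - a) := fun a =>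
    (integrable_gaussKernel hh).comp_sub_right a
  have hk1 : ∀ a : E, ∫ x in s, gaussKernel h (x - a) ≤ 1 := by
    intro a
    refine (setIntegral_le_integral (hk a)
      (.of_forall fun x => gaussKernel_nonneg hh.le _)).trans ?_
    rw [integral_sub_right_eq_self (gaussKernel h), integral_gaussKernel hh]
  have hpt : ∀ x, |gaussEstimate h X x - gaussSmooth h f x|
      ≤ |gaussEstimate h (Function.update X i y) x - gaussSmooth h f x|
        + 1 / n * (gaussKernel h (x - X i) + gaussKernel h (x - y)) := by
    intro x
    have e : gaussEstimate h X x - gaussEstimate h (Function.update X i y) x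
        = 1 / n * (gaussKernel h (x - X i) - gaussKernel h (x - y)) := by
      unfold gaussEstimate
      rw [← mul_sub, ← Finset.sum_sub_distrib, Finset.sum_eq_single i]
      · simp
      · intro j _ hj; simp [hj]
      · simp
    have h1 : |gaussEstimate h X x - gaussEstimate h (Function.update X i y) x|
        ≤ 1 / n * (gaussKernel h (x - X i) + gaussKernel h (x - y)) := by
      rw [e, abs_mul, abs_of_nonneg (by positivity : (0 : ℝ) ≤ 1 / n)]
      gcongr
      have := gaussKernel_nonneg hh.le (x - X i)
      have := gaussKernel_nonneg hh.le (x - y)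
      rw [abs_le]; constructor <;> linarith
    have := abs_sub_le (gaussEstimate h X x) (gaussEstimate h (Function.update X i y) x)
      (gaussSmooth h f x)
    linarith
  have hi := integrableOn_abs_gaussEstimate_sub hf hf0 hμ hh hn hs
  have hi2 : IntegrableOn
      (fun x => 1 / (n : ℝ) * (gaussKernel h (x - X i) + gaussKernel h (x - y))) s :=
    (((hk _).add (hk _)).const_mul _).integrableOn
  unfold gaussDeviation
  refine (integral_mono (hi X) ((hi _).add hi2) hpt).trans ?_
  simp only [Pi.add_apply]
  rw [integral_add (hi _) hi2, integral_const_mul,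
    integral_add (hk _).integrableOn (hk _).integrableOn]
  have := hk1 (X i)
  have := hk1 y
  have h2 : 1 / (n : ℝ) * ((∫ x in s, gaussKernel h (x - X i)) + ∫ x in s, gaussKernel h (x - y))
      ≤ 1 / n * (1 + 1) := by gcongr
  have h3 : 1 / (n : ℝ) * (1 + 1) = 2 / n := by ring
  linarith

theorem integral_gaussEstimate (hf : Measurable f) (hf0 : ∀ x, 0 ≤ f x)
    (hμ : μ = volume.withDensity fun x => ENNReal.ofReal (f x)) (hh : 0 < h) (hn : n ≠ 0) (x : E) :
    ∫ X : Fin n → E, gaussEstimate h X x ∂(Measure.pi fun _ => μ) = gaussSmooth h f x := by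
  have hn' : (n : ℝ) ≠ 0 := by exact_mod_cast hn
  have hk2 := memLp_gaussKernel_sub (μ := μ) hh x
  have hev : ∀ i : Fin n, Integrable (fun X : Fin n → E => gaussKernel h (x - X i))
      (Measure.pi fun _ => μ) := fun i =>
    integrable_comp_eval (μ := fun _ => μ) (i := i) (hk2.integrable (by norm_num))
  unfold gaussEstimate
  rw [integral_const_mul, integral_finsetSum _ fun i _ => hev i]
  have : ∀ i : Fin n, ∫ X : Fin n → E, gaussKernel h (x - X i) ∂(Measure.pi fun _ => μ)
      = gaussSmooth h f x := by
    intro i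
    rw [← integral_gaussKernel_sub_eq_gaussSmooth hf hf0, ← hμ]
    exact integral_comp_eval (μ := fun _ => μ) (i := i) (f := fun u => gaussKernel h (x - u))
      hk2.aestronglyMeasurable
  rw [Finset.sum_congr rfl fun i _ => this i, Finset.sum_const, Finset.card_univ, Fintype.card_fin,
    nsmul_eq_mul]
  field_simp

theorem integral_abs_gaussEstimate_sub_le (hf : Measurable f) (hf0 : ∀ x, 0 ≤ f x)
    (hμ : μ = volume.withDensity fun x => ENNReal.ofReal (f x)) (hh : 0 < h) (hn : n ≠ 0)
    {M : ℝ} (hM : ∀ᵐ x, f x ≤ M) (x : E) :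
    ∫ X : Fin n → E, |gaussEstimate h X x - gaussSmooth h f x| ∂(Measure.pi fun _ => μ)
      ≤ √(M / (h * √(4 * Real.pi)) ^ finrank ℝ E / n) := by
  have hn' : (n : ℝ) ≠ 0 := by exact_mod_cast hn
  have hm : Measurable fun X : Fin n → E => gaussEstimate h X x := by
    unfold gaussEstimate; fun_prop
  have hL : MemLp (fun X : Fin n → E => gaussEstimate h X x) 2 (Measure.pi fun _ => μ) :=
    MemLp.of_bound hm.aestronglyMeasurable (1 / (h * √(2 * Real.pi)) ^ finrank ℝ E)
      (.of_forall fun X => by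
        have := gaussEstimate_mem_Icc hh hn X x
        rw [Real.norm_of_nonneg this.1]; exact this.2)
  have h1 := integral_abs_sub_integral_le_sqrt_variance hL
  rw [integral_gaussEstimate hf hf0 hμ hh hn] at h1
  refine h1.trans (Real.sqrt_le_sqrt ?_)
  rw [variance_gaussEstimate hh]
  have h2 := (variance_le_expectation_sq (μ := μ)
    (memLp_gaussKernel_sub hh x).aestronglyMeasurable).trans
    (integral_gaussKernel_sq_le hf hf0 hμ hh hM x)
  generalize M / (h * √(4 * Real.pi)) ^ finrank ℝ E = b at h2 ⊢
  calc _ ≤ (1 / (n : ℝ)) ^ 2 * (n * b) := by gcongr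
    _ = _ := by field_simp

theorem integral_gaussDeviation_le (hf : Measurable f) (hf0 : ∀ x, 0 ≤ f x)
    (hμ : μ = volume.withDensity fun x => ENNReal.ofReal (f x)) (hh : 0 < h) (hn : n ≠ 0)
    {M : ℝ} (hM : ∀ᵐ x, f x ≤ M) (hs : volume s ≠ ⊤) :
    ∫ X : Fin n → E, gaussDeviation h f s X ∂(Measure.pi fun _ => μ)
      ≤ volume.real s * √(M / (h * √(4 * Real.pi)) ^ finrank ℝ E / n) := by
  have : IsFiniteMeasure (volume.restrict s) := ⟨by simpa using hs.lt_top⟩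
  set ν : Measure (Fin n → E) := Measure.pi fun _ => μ
  have hi : Integrable (Function.uncurry fun (X : Fin n → E) x =>
      |gaussEstimate h X x - gaussSmooth h f x|) (ν.prod (volume.restrict s)) := by
    refine Integrable.of_mem_Icc 0 (1 / (h * √(2 * Real.pi)) ^ finrank ℝ E) ?_
      (.of_forall fun p => ⟨abs_nonneg _, abs_gaussEstimate_sub_le hf hf0 hμ hh hn p.1 p.2⟩)
    exact (((measurable_gaussEstimate h n).sub
        ((measurable_gaussSmooth h hf).comp measurable_snd)).abs).aemeasurable
  unfold gaussDeviation
  rw [integral_integral_swap hi]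
  have := integral_mono (hi.swap.integral_prod_left) (integrable_const _)
    (integral_abs_gaussEstimate_sub_le hf hf0 hμ hh hn hM)
  simpa using this

/-- Concentration of the `L¹` deviation of the kernel density estimate. -/
theorem measure_gaussDeviation_ge_le (hf : Measurable f) (hf0 : ∀ x, 0 ≤ f x)
    (hμ : μ = volume.withDensity fun x => ENNReal.ofReal (f x)) (hh : 0 < h) (hn : n ≠ 0)
    {M : ℝ} (hM : ∀ᵐ x, f x ≤ M) (hs : volume s ≠ ⊤) :
    (Measure.pi fun _ : Fin n => μ).real
      {X | volume.real s * √(M / (h * √(4 * Real.pi)) ^ finrank ℝ E / n) + √(2 * Real.log n / n)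
        ≤ gaussDeviation h f s X} ≤ 1 / n := by
  have hn0 : (0 : ℝ) < n := by exact_mod_cast Nat.pos_of_ne_zero hn
  have hlog : 0 ≤ Real.log n := Real.log_natCast_nonneg n
  -- With `c = 2 / n` the tail is `exp (-n ε² / 2)`, equal to `1 / n` at `ε² = 2 log n / n`.
  have := measure_ge_le_of_boundedDifferences (μ := μ) (c := 2 / n)
    (measurable_gaussDeviation hf h s n) (gaussDeviation_mem_Icc hf hf0 hμ hh hn hs)
    (fun X i y => by
      push_cast; exact gaussDeviation_le_update_add hf hf0 hμ hh hn hs X i y)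
    (Real.sqrt_nonneg (2 * Real.log n / n))
  refine (measureReal_mono fun X hX => ?_).trans (this.trans_eq ?_)
  · have h2 := integral_gaussDeviation_le (n := n) hf hf0 hμ hh hn hM hs
    simp only [Set.mem_ofPred_eq] at hX ⊢
    linarith
  · rw [Real.sq_sqrt (by positivity), one_div, ← Real.exp_log hn0, ← Real.exp_neg, Real.exp_log hn0]
    congr 1
    push_cast
    field_simp

end Deviation

/-! ### Regret against the `L¹` error of the density. -/

section Regret

variable {S A : Type*} [MeasurableSpace S] [MeasurableSpace A] {d : ℕ}
  {Θ : Set (EuclideanSpace ℝ (Fin d))} {g : Θ → MDP S A} {T : ℕ} {Cmax : ℝ}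
  {f p : EuclideanSpace ℝ (Fin d) → ℝ}

theorem integrableOn_iff_subtype (hΘ : MeasurableSet Θ) :
    IntegrableOn f Θ ↔ Integrable (fun θ : Θ => f θ) (volume.comap Subtype.val) := by
  rw [IntegrableOn, ← map_comap_subtype_coe hΘ,
    (MeasurableEmbedding.subtype_coe hΘ).integrable_map_iff]
  rfl

theorem integrable_expectedCost_mul (hΘ : MeasurableSet Θ) (hg : IsMeasurableFamily g)
    (hC : CostsIn g Cmax) (hf : IntegrableOn f Θ) (π : Policy S A) :
    Integrable (fun θ : Θ => (g θ).expectedCost π T * f θ) (volume.comap Subtype.val) := by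
  refine ((integrableOn_iff_subtype hΘ).1 hf).bdd_mul (c := T * Cmax)
    (MDP.measurable_expectedCost hg.init hg.cost hg.trans hg.horizon π T).aestronglyMeasurable
    (.of_forall fun θ => ?_)
  have := (g θ).expectedCost_mem_Icc π (hC θ) T
  rw [Real.norm_of_nonneg this.1]
  exact this.2

theorem bayesCost_mem_Icc (hΘ : MeasurableSet Θ) (hg : IsMeasurableFamily g)
    (hC : CostsIn g Cmax) (hf : IntegrableOn f Θ) (hf0 : ∀ x, 0 ≤ f x) (π : Policy S A) :
    bayesCost g T f π ∈ Set.Icc 0 (T * Cmax * ∫ x in Θ, f x) := by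
  refine ⟨integral_nonneg fun θ =>
    mul_nonneg ((g θ).expectedCost_mem_Icc π (hC θ) T).1 (hf0 _), ?_⟩
  rw [← integral_subtype_comap hΘ, ← integral_const_mul]
  refine integral_mono (integrable_expectedCost_mul hΘ hg hC hf π)
    (((integrableOn_iff_subtype hΘ).1 hf).const_mul _) fun θ => ?_
  exact mul_le_mul_of_nonneg_right ((g θ).expectedCost_mem_Icc π (hC θ) T).2 (hf0 _)

theorem regret_le_mul_integral (hΘ : MeasurableSet Θ) (hg : IsMeasurableFamily g)
    (hC : CostsIn g Cmax) (hf : IntegrableOn f Θ) (hf0 : ∀ x, 0 ≤ f x) (π : Policy S A) :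
    regret g T f π ≤ T * Cmax * ∫ x in Θ, f x := by
  have : Nonempty (Policy S A) := ⟨π⟩
  have h1 : 0 ≤ ⨅ π' : Policy S A, bayesCost g T f π' :=
    le_ciInf fun π' => (bayesCost_mem_Icc hΘ hg hC hf hf0 π').1
  have h2 := (bayesCost_mem_Icc (T := T) hΘ hg hC hf hf0 π).2
  unfold regret
  linarith

theorem regret_le_of_isBayesOptimal (hΘ : MeasurableSet Θ) (hg : IsMeasurableFamily g)
    (hC : CostsIn g Cmax) (hf : IntegrableOn f Θ) (hp : IntegrableOn p Θ) {π : Policy S A}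
    (hπ : IsBayesOptimal g T p π) :
    regret g T f π ≤ T * Cmax * ∫ x in Θ, |f x - p x| := by
  have : Nonempty (Policy S A) := ⟨π⟩
  have hi := fun π' => integrable_expectedCost_mul (T := T) hΘ hg hC hf π'
  have hj := fun π' => integrable_expectedCost_mul (T := T) hΘ hg hC hp π'
  have hd : Integrable (fun θ : Θ => |f θ - p θ|) (volume.comap Subtype.val) :=
    (integrableOn_iff_subtype (f := fun x => |f x - p x|) hΘ).1 (hf.sub hp).abs
  have key : ∀ π' : Policy S A, bayesCost g T f π - T * Cmax * ∫ x in Θ, |f x - p x|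
      ≤ bayesCost g T f π' := by
    intro π'
    -- Grouping the four costs as the integral of `(L_π - L_π') (f - p)` gives the constant `T *
    -- Cmax`; comparing `f` with `p` for each policy separately would double it.
    have h1 : bayesCost g T f π + bayesCost g T p π'
        ≤ bayesCost g T f π' + bayesCost g T p π + T * Cmax * ∫ x in Θ, |f x - p x| := by
      unfold bayesCost
      have e := integral_add ((hi π').add (hj π)) (hd.const_mul (T * Cmax))
      simp only [Pi.add_apply] at e
      rw [integral_add (hi π') (hj π), integral_const_mul] at e
      rw [← integral_subtype_comap hΘ (fun x => |f x - p x|), ← integral_add (hi π) (hj π'), ← e]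
      refine integral_mono ((hi π).add (hj π')) (((hi π').add (hj π)).add (hd.const_mul _))
        fun θ => ?_
      have ha := (g θ).expectedCost_mem_Icc π (hC θ) T
      have hb := (g θ).expectedCost_mem_Icc π' (hC θ) T
      have h2 : ((g θ).expectedCost π T - (g θ).expectedCost π' T) * (f θ - p θ)
          ≤ T * Cmax * |f θ - p θ| := by
        refine (le_abs_self _).trans ?_
        rw [abs_mul]
        gcongr
        rw [abs_le]
        constructor <;> linarith [ha.1, ha.2, hb.1, hb.2]
      linarith
    have := hπ π'
    linarith
  have := le_ciInf key
  unfold regret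
  linarith

end Regret

/-! ### Consequences of the assumptions on the prior. -/

section Prior

open Module

variable {d : ℕ} {Θ : Set (EuclideanSpace ℝ (Fin d))} {f : EuclideanSpace ℝ (Fin d) → ℝ}

theorem measureReal_pos_of_setIntegral_ne_zero {X : Type*} [MeasurableSpace X] {ν : Measure X}
    {s : Set X} {φ : X → ℝ} (hs : ν s ≠ ⊤) (hφ : ∫ x in s, φ x ∂ν ≠ 0) : 0 < ν.real s := by
  refine measureReal_nonneg.lt_of_ne fun h0 => hφ (setIntegral_measure_zero _ ?_)
  exact ((ENNReal.toReal_eq_zero_iff _).1 h0.symm).resolve_right hs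

theorem gaussianKDE_eq_gaussEstimate {n : ℕ} (h : ℝ) (X : Fin n → EuclideanSpace ℝ (Fin d)) :
    gaussianKDE h X = gaussEstimate h X := by
  funext x
  simp only [gaussianKDE, gaussEstimate, gaussKernel, finrank_euclideanSpace_fin, Finset.mul_sum]
  refine Finset.sum_congr rfl fun i _ => ?_
  rw [← mul_assoc, one_div_mul_one_div]

theorem EuclideanSpace.norm_le_sum_abs (x : EuclideanSpace ℝ (Fin d)) : ‖x‖ ≤ ∑ i, |x i| := by
  rw [EuclideanSpace.norm_eq]
  refine Real.sqrt_le_iff.2 ⟨Finset.sum_nonneg fun i _ => abs_nonneg _, ?_⟩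
  exact Finset.sum_sq_le_sq_sum_of_nonneg fun i _ => abs_nonneg _

theorem norm_sub_le_l1Diameter (hΘ : Bornology.IsBounded Θ) {x y : EuclideanSpace ℝ (Fin d)}
    (hx : x ∈ Θ) (hy : y ∈ Θ) : ‖x - y‖ ≤ l1Diameter Θ := by
  obtain ⟨R, hR⟩ := Metric.isBounded_iff.1 hΘ
  -- Boundedness of `Θ` is essential here: a real `sSup` of an unbounded set would be `0`.
  refine (EuclideanSpace.norm_le_sum_abs _).trans (le_csSup ⟨d * R, ?_⟩ ⟨x, hx, y, hy, rfl⟩)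
  rintro _ ⟨a, ha, b, hb, rfl⟩
  calc ∑ i, |a i - b i| ≤ ∑ _i : Fin d, R := by
        refine Finset.sum_le_sum fun i _ => ?_
        have h1 := PiLp.norm_apply_le (a - b) i
        rw [PiLp.sub_apply, Real.norm_eq_abs] at h1
        exact h1.trans ((dist_eq_norm a b).symm.trans_le (hR ha hb))
    _ = _ := by simp

theorem ae_eq_zero_of_densityMeasure_compl (hΘm : MeasurableSet Θ) (hf : Measurable f)
    (hf0 : ∀ x, 0 ≤ f x) (hfΘ : densityMeasure f Θᶜ = 0) : ∀ᵐ x, x ∉ Θ → f x = 0 := by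
  rw [densityMeasure, withDensity_apply _ hΘm.compl, lintegral_eq_zero_iff hf.ennreal_ofReal,
    Filter.EventuallyEq, ae_restrict_iff' hΘm.compl] at hfΘ
  filter_upwards [hfΘ] with x hx hxΘ
  have := hx hxΘ
  simp only [Pi.zero_apply, ENNReal.ofReal_eq_zero] at this
  exact le_antisymm this (hf0 x)

theorem integrable_of_densityMeasure (hf : Measurable f) (hf0 : ∀ x, 0 ≤ f x)
    (hf1 : IsProbabilityMeasure (densityMeasure f)) : Integrable f ∧ ∫ x, f x = 1 := by
  have h1 : ∫⁻ x, ENNReal.ofReal (f x) = 1 := by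
    have := hf1.measure_univ
    rwa [densityMeasure, withDensity_apply _ .univ, Measure.restrict_univ] at this
  refine ⟨?_, ?_⟩
  · refine ⟨hf.aestronglyMeasurable, ?_⟩
    rw [hasFiniteIntegral_iff_ofReal (.of_forall hf0), h1]
    exact ENNReal.one_lt_top
  · rw [integral_eq_lintegral_of_nonneg_ae (.of_forall hf0) hf.aestronglyMeasurable, h1,
      ENNReal.toReal_one]

theorem ae_le_of_holder (hΘm : MeasurableSet Θ) (hΘb : Bornology.IsBounded Θ)
    (hfi : IntegrableOn f Θ) (hfint : ∫ x in Θ, f x = 1) (hV : 0 < volume.real Θ)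
    (hfs : ∀ᵐ x, x ∉ Θ → f x = 0) {α Cα : ℝ} (hα0 : 0 < α) (hCα : 0 < Cα)
    (hfα : ∀ x y, |f x - f y| ≤ Cα * ‖x - y‖ ^ α) :
    ∀ᵐ x, f x ≤ Cα * l1Diameter Θ ^ α + 1 / volume.real Θ := by
  have hΘt : volume Θ ≠ ⊤ := hΘb.measure_lt_top.ne
  obtain ⟨x0, hx0⟩ := nonempty_of_measureReal_ne_zero hV.ne'
  have hΔ : 0 ≤ l1Diameter Θ := (norm_nonneg _).trans (norm_sub_le_l1Diameter hΘb hx0 hx0)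
  filter_upwards [hfs] with x hx
  by_cases hxΘ : x ∈ Θ
  · have h1 : ∫ _y in Θ, (f x - Cα * l1Diameter Θ ^ α) ≤ ∫ y in Θ, f y := by
      refine setIntegral_mono_on (integrableOn_const hΘt) hfi hΘm fun y hy => ?_
      have h2 := (le_abs_self _).trans (hfα x y)
      have h3 : Cα * ‖x - y‖ ^ α ≤ Cα * l1Diameter Θ ^ α := by
        gcongr
        exact norm_sub_le_l1Diameter hΘb hxΘ hy
      linarith
    rw [hfint, setIntegral_const, smul_eq_mul] at h1
    rw [← sub_le_iff_le_add', le_div_iff₀ hV]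
    linarith
  · rw [hx hxΘ]; positivity

end Prior

/-! ### Choice of bandwidth and numerical constants. -/

section Rate

/-- Used with `q = h ^ α`, `D = h ^ d`, `w = (2π) ^ (d / 2)`, `w' = (4π) ^ (d / 2)`, `ℓ = log n` and
`B` the bias bound. The variance term contributes `2` and the McDiarmid term `3`; the latter uses `D
≤ 4 V / w` and `1 ≤ V F`. -/
theorem stochasticError_le {V q D w w' F ℓ n B : ℝ} (hV : 0 < V) (hq : 0 < q) (hD : 0 < D)
    (hw : 0 < w) (hww : w ≤ w') (hF : 1 / V ≤ F) (hℓ : 1 / 2 ≤ ℓ) (hn : 0 < n)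
    (hqD : ℓ / n = q ^ 2 * D) (hB : B ≤ 3 / 4) (hBV : 1 - B ≤ V / (D * w)) :
    V * √(F / (D * w') / n) + √(2 * ℓ / n) ≤ 5 * (V * q * (√F / √w)) := by
  have hF0 : 0 < F := (by positivity : 0 < 1 / V).trans_le hF
  have hw' : 0 < w' := hw.trans_le hww
  have hsq : (√F / √w) ^ 2 = F / w := by
    rw [div_pow, Real.sq_sqrt hF0.le, Real.sq_sqrt hw.le]
  have h1 : √(F / (D * w') / n) ≤ 2 * (q * (√F / √w)) := by
    refine Real.sqrt_le_iff.2 ⟨by positivity, ?_⟩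
    rw [mul_pow, mul_pow, hsq]
    have e : 1 / n ≤ 2 * (q ^ 2 * D) := by
      rw [← hqD, ← mul_div_assoc]; gcongr; linarith
    calc F / (D * w') / n = F / (D * w') * (1 / n) := by ring
      _ ≤ F / (D * w) * (2 * (q ^ 2 * D)) := by gcongr
      _ = 2 * (q ^ 2 * (F / w)) := by field_simp
      _ ≤ 2 ^ 2 * (q ^ 2 * (F / w)) := by gcongr; norm_num
  have h2 : √(2 * ℓ / n) ≤ 3 * (V * q * (√F / √w)) := by
    refine Real.sqrt_le_iff.2 ⟨by positivity, ?_⟩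
    rw [mul_pow, mul_pow, mul_pow, hsq, mul_div_assoc, hqD]
    have hDV : D ≤ 4 * V / w := by
      have : 1 / 4 ≤ V / (D * w) := by linarith
      rw [div_le_div_iff₀ (by norm_num) (by positivity)] at this
      rw [le_div_iff₀ hw]; linarith
    have hVF : V ≤ V ^ 2 * F := by
      rw [div_le_iff₀ hV] at hF; nlinarith
    calc 2 * (q ^ 2 * D) ≤ 2 * (q ^ 2 * (4 * V / w)) := by gcongr
      _ = 8 * (q ^ 2 * (V / w)) := by ring
      _ ≤ 3 ^ 2 * (q ^ 2 * (V ^ 2 * F / w)) := by gcongr; norm_num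
      _ = _ := by ring
  nlinarith [mul_le_mul_of_nonneg_left h1 hV.le]

theorem two_thirds_le_two_rpow {α : ℝ} (hα : 0 ≤ α) : (2 / 3 : ℝ) ≤ 2 ^ ((α - 1) / 2) := by
  calc (2 / 3 : ℝ) ≤ 2 ^ (-(1 / 2) : ℝ) := by
        rw [Real.rpow_neg (by norm_num), ← Real.sqrt_eq_rpow, ← one_div,
          div_le_div_iff₀ (by norm_num) (by positivity)]
        have : √2 ≤ 3 / 2 := Real.sqrt_le_iff.2 ⟨by norm_num, by norm_num⟩
        linarith
    _ ≤ _ := Real.rpow_le_rpow_of_exponent_le (by norm_num) (by linarith)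

theorem two_pi_rpow_div_four (d : ℕ) :
    (2 * Real.pi) ^ ((d : ℝ) / 4) = √(√(2 * Real.pi) ^ d) := by
  rw [Real.sqrt_eq_rpow, Real.sqrt_eq_rpow, ← Real.rpow_mul_natCast (by positivity),
    ← Real.rpow_mul (by positivity)]
  congr 1; ring

/-- After multiplication by `2 V q` the left side is `4 / 3` of the bias bound plus the stochastic
bound. The last summand of `kdeConst` is only needed to be nonnegative. -/
theorem le_kdeConst {d : ℕ} (hd : 0 < d) (Θ : Set (EuclideanSpace ℝ (Fin d))) {α Cα : ℝ}
    (hα : 0 ≤ α) (hCα : 0 ≤ Cα) :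
    2 / 3 * Cα + 5 / 2 * (√(Cα * l1Diameter Θ ^ α + 1 / volume.real Θ) / √(√(2 * Real.pi) ^ d))
      ≤ kdeConst Θ α Cα := by
  unfold kdeConst
  rw [two_pi_rpow_div_four]
  set r := √(Cα * l1Diameter Θ ^ α + 1 / volume.real Θ)
  set v := √(√(2 * Real.pi) ^ d)
  have h1 := mul_le_mul_of_nonneg_left (two_thirds_le_two_rpow hα) hCα
  have h2 : 5 / 2 * (r / v) ≤ 16 * d * r / (√2 * v) := by
    have hd' : (1 : ℝ) ≤ d := by exact_mod_cast hd
    have : √2 ≤ 3 / 2 := Real.sqrt_le_iff.2 ⟨by norm_num, by norm_num⟩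
    have h3 : 5 / 2 ≤ 16 * (d : ℝ) / √2 := by
      rw [le_div_iff₀ (by positivity)]; linarith
    calc 5 / 2 * (r / v) ≤ 16 * (d : ℝ) / √2 * (r / v) := by gcongr
      _ = _ := by field_simp
  have h3 : 0 ≤ 64 * (d : ℝ) ^ 2 / (2 * Real.pi) ^ ((d : ℝ) / 2) := by positivity
  linarith

theorem optimalBandwidth_pos {d n : ℕ} (hn : 2 ≤ n) (α : ℝ) : 0 < optimalBandwidth d n α := by
  have hn' : (2 : ℝ) ≤ n := by exact_mod_cast hn
  have := Real.log_pos (by linarith : (1 : ℝ) < n)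
  unfold optimalBandwidth
  positivity

theorem optimalBandwidth_rpow {d n : ℕ} (α : ℝ) :
    optimalBandwidth d n α ^ α = (Real.log n / n) ^ (α / (2 * α + d)) := by
  have := Real.log_natCast_nonneg n
  rw [optimalBandwidth, ← Real.rpow_mul (by positivity)]
  congr 1; ring

theorem log_div_eq_optimalBandwidth {d n : ℕ} {α : ℝ} (hα : 0 < α) :
    Real.log n / n = (optimalBandwidth d n α ^ α) ^ 2 * optimalBandwidth d n α ^ d := by
  have := Real.log_natCast_nonneg n
  have hne : 2 * α + d ≠ 0 := by positivity
  have h0 : 0 ≤ Real.log n / n := by positivity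
  rw [optimalBandwidth_rpow, optimalBandwidth, ← Real.rpow_natCast, ← Real.rpow_natCast,
    ← Real.rpow_mul h0, ← Real.rpow_mul h0, ← Real.rpow_add' h0]
  · have : α / (2 * α + d) * ((2 : ℕ) : ℝ) + 1 / (2 * α + d) * d = 1 := by
      push_cast; field_simp
    rw [this, Real.rpow_one]
  · have : α / (2 * α + d) * ((2 : ℕ) : ℝ) + 1 / (2 * α + d) * d = 1 := by
      push_cast; field_simp
    rw [this]; exact one_ne_zero

end Rate

/-! ### Assembly of the error bound and the theorem. -/

section Main

open Module

variable {d n : ℕ} {Θ : Set (EuclideanSpace ℝ (Fin d))} {f : EuclideanSpace ℝ (Fin d) → ℝ}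

theorem integral_abs_sub_gaussSmooth_le (hΘm : MeasurableSet Θ) (hΘb : Bornology.IsBounded Θ)
    (hf0 : ∀ x, 0 ≤ f x) (hfb : BddAbove (Set.range f)) {α Cα h : ℝ} (hα0 : 0 < α) (hα1 : α ≤ 1)
    (hCα : 0 < Cα) (hfα : ∀ x y, |f x - f y| ≤ Cα * ‖x - y‖ ^ α) (hh : 0 < h)
    (hfs : ∀ᵐ x, x ∉ Θ → f x = 0) :
    ∫ x in Θ, |f x - gaussSmooth h f x| ≤ Cα * h ^ α * volume.real Θ := by
  have hfm := (continuous_of_abs_sub_le_mul_rpow hα0 hfα).measurable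
  have hb := setLIntegral_abs_sub_gaussAverage_le hf0 hfb hα0 hα1 hCα hfα hh hΘm hΘb hfs
  have hm : Measurable fun x => |f x - gaussSmooth h f x| :=
    (hfm.sub (measurable_gaussSmooth h hfm)).abs
  rw [integral_eq_lintegral_of_nonneg_ae (.of_forall fun x => abs_nonneg _)
    hm.aestronglyMeasurable]
  refine ENNReal.toReal_le_of_le_ofReal (by positivity) (hb.trans_eq ?_)
  rw [ENNReal.ofReal_mul (by positivity : 0 ≤ Cα * h ^ α), Measure.real,
    ENNReal.ofReal_toReal hΘb.measure_lt_top.ne]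

/-- On the event that the stochastic error is small, the total `L¹` error, truncated at `1`, is at
most the claimed rate. -/
theorem one_le_or_integral_abs_sub_le (hd : 0 < d) (hn : 2 ≤ n) (hΘm : MeasurableSet Θ)
    (hΘb : Bornology.IsBounded Θ) (hf0 : ∀ x, 0 ≤ f x)
    (hf1 : IsProbabilityMeasure (densityMeasure f)) (hfΘ : densityMeasure f Θᶜ = 0)
    (hfb : BddAbove (Set.range f)) {α Cα : ℝ} (hα0 : 0 < α) (hα1 : α ≤ 1) (hCα : 0 < Cα)
    (hfα : ∀ x y, |f x - f y| ≤ Cα * ‖x - y‖ ^ α) (X : Fin n → EuclideanSpace ℝ (Fin d))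
    (hX : gaussDeviation (optimalBandwidth d n α) f Θ X
      < volume.real Θ * √((Cα * l1Diameter Θ ^ α + 1 / volume.real Θ)
          / (optimalBandwidth d n α * √(4 * Real.pi)) ^ d / n) + √(2 * Real.log n / n)) :
    1 ≤ 2 * volume.real Θ * kdeConst Θ α Cα * optimalBandwidth d n α ^ α ∨
      ∫ x in Θ, |f x - gaussEstimate (optimalBandwidth d n α) X x|
        ≤ 2 * volume.real Θ * kdeConst Θ α Cα * optimalBandwidth d n α ^ α := by
  have hqD := log_div_eq_optimalBandwidth (d := d) (n := n) hα0
  have hh := optimalBandwidth_pos (d := d) hn α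
  generalize optimalBandwidth d n α = h at *
  have hfm := (continuous_of_abs_sub_le_mul_rpow hα0 hfα).measurable
  have hfs := ae_eq_zero_of_densityMeasure_compl hΘm hfm hf0 hfΘ
  obtain ⟨hfi, hfint⟩ := integrable_of_densityMeasure hfm hf0 hf1
  have hΘt : volume Θ ≠ ⊤ := hΘb.measure_lt_top.ne
  have hfΘ1 : ∫ x in Θ, f x = 1 := by
    rw [setIntegral_eq_integral_of_ae_compl_eq_zero hfs, hfint]
  have hn0 : n ≠ 0 := by omega
  have hn' : (2 : ℝ) ≤ n := by exact_mod_cast hn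
  have hV : 0 < volume.real Θ :=
    measureReal_pos_of_setIntegral_ne_zero hΘt (φ := f) (by simp [hfΘ1])
  have hbias := integral_abs_sub_gaussSmooth_le hΘm hΘb hf0 hfb hα0 hα1 hCα hfα hh hfs
  have hconst := le_kdeConst hd Θ hα0.le hCα.le
  obtain ⟨x0, hx0⟩ := nonempty_of_measureReal_ne_zero hV.ne'
  have hΔ : 0 ≤ l1Diameter Θ := (norm_nonneg _).trans (norm_sub_le_l1Diameter hΘb hx0 hx0)
  have hF : 1 / volume.real Θ ≤ Cα * l1Diameter Θ ^ α + 1 / volume.real Θ :=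
    le_add_of_nonneg_left (by positivity)
  set F := Cα * l1Diameter Θ ^ α + 1 / volume.real Θ
  set V := volume.real Θ
  set q := h ^ α
  have hq : 0 < q := by positivity
  have hVq : 0 < 2 * V * q := by positivity
  have hR := mul_le_mul_of_nonneg_left hconst hVq.le
  have hv : 0 ≤ √F / √(√(2 * Real.pi) ^ d) := by positivity
  have hvV := mul_nonneg hVq.le hv
  -- In the first case `4 / 3` of the bias bound is already at least `1`.
  by_cases hB : 3 / 4 ≤ Cα * q * V
  · left
    nlinarith
  · right
    have hfin : IsFiniteMeasure (volume.restrict Θ) := ⟨by simpa using hΘt.lt_top⟩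
    have hSm := gaussSmooth_mem_Icc (μ := densityMeasure f) hfm hf0 rfl hh
    have hSi : IntegrableOn (gaussSmooth h f) Θ :=
      Integrable.of_mem_Icc _ _ (measurable_gaussSmooth h hfm).aemeasurable (.of_forall hSm)
    have hS1 : ∫ x in Θ, gaussSmooth h f x ≤ V / (h ^ d * √(2 * Real.pi) ^ d) := by
      have := integral_mono hSi (integrable_const _) fun x => (hSm x).2
      rw [integral_const, finrank_euclideanSpace_fin, mul_pow] at this
      simpa [V, div_eq_mul_inv] using this
    -- The smoothed density has mass at least one minus the bias on `Θ`, and by `hS1` at most `V`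
    -- times the peak of the kernel.
    have hS2 : 1 - Cα * q * V ≤ ∫ x in Θ, gaussSmooth h f x := by
      have h1 : ∫ x in Θ, (f x - gaussSmooth h f x) ≤ ∫ x in Θ, |f x - gaussSmooth h f x| :=
        integral_mono (hfi.integrableOn.sub hSi) (hfi.integrableOn.sub hSi).abs
          fun x => le_abs_self _
      rw [integral_sub hfi.integrableOn hSi, hfΘ1] at h1
      linarith
    have hlog : 1 / 2 ≤ Real.log n := by
      have := Real.log_le_log (by norm_num) hn'
      linarith [Real.log_two_gt_d9]
    have hstoch := stochasticError_le (w' := √(4 * Real.pi) ^ d) hV hq (pow_pos hh d)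
      (by positivity : 0 < √(2 * Real.pi) ^ d)
      (by gcongr; norm_num) hF hlog (by linarith : (0 : ℝ) < n) hqD (not_le.1 hB).le (hS2.trans hS1)
    rw [mul_pow] at hX
    have hdev := integrableOn_abs_gaussEstimate_sub (μ := densityMeasure f) hfm hf0 rfl hh hn0 hΘt X
    have htri : ∫ x in Θ, |f x - gaussEstimate h X x|
        ≤ (∫ x in Θ, |f x - gaussSmooth h f x|) + gaussDeviation h f Θ X := by
      have hfS : IntegrableOn (fun x => |f x - gaussSmooth h f x|) Θ :=
        (hfi.integrableOn.sub hSi).abs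
      unfold gaussDeviation
      rw [← integral_add hfS hdev]
      refine integral_mono_of_nonneg (.of_forall fun x => abs_nonneg _)
        (hfS.add hdev) (.of_forall fun x => ?_)
      have := abs_sub_le (f x) (gaussSmooth h f x) (gaussEstimate h X x)
      rwa [abs_sub_comm (gaussSmooth h f x)] at this
    have hBnn : 0 ≤ Cα * q * V := by positivity
    linarith

end Main

theorem mainTheorem1 {d n T : ℕ} (hd : 0 < d) (hn : 2 ≤ n)
    -- the bounded parameter space
    (Θ : Set (EuclideanSpace ℝ (Fin d))) (hΘm : MeasurableSet Θ) (hΘb : Bornology.IsBounded Θ)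
    -- the MDPs and their parametrization
    {S A : Type*} [MeasurableSpace S] [MeasurableSpace A]
    (g : Θ → MDP S A) (hg : IsMeasurableFamily g) (Cmax : ℝ) (hC : CostsIn g Cmax)
    -- the prior: a probability density on `Θ`, bounded and Hölder continuous
    (f : EuclideanSpace ℝ (Fin d) → ℝ) (hf0 : ∀ x, 0 ≤ f x)
    (hf1 : IsProbabilityMeasure (densityMeasure f)) (hfΘ : densityMeasure f Θᶜ = 0)
    (hfb : BddAbove (Set.range f))
    (α Cα : ℝ) (hα0 : 0 < α) (hα1 : α ≤ 1) (hCα : 0 < Cα)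
    (hfα : ∀ x y, |f x - f y| ≤ Cα * ‖x - y‖ ^ α)
    -- the training sample: `n` independent draws from the prior
    {Ω : Type*} [MeasurableSpace Ω] (P : Measure Ω) [IsProbabilityMeasure P]
    (X : Fin n → Ω → EuclideanSpace ℝ (Fin d)) (hXm : ∀ i, Measurable (X i))
    (hXi : iIndepFun X P) (hXf : ∀ i, P.map (X i) = densityMeasure f) :
    ∃ E : Set Ω, MeasurableSet E ∧ ENNReal.ofReal (1 - 1 / n) ≤ P E ∧
      ∀ ω ∈ E, ∀ π : Policy S A,
        IsBayesOptimal g T (gaussianKDE (optimalBandwidth d n α) fun i => X i ω) π →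
          regret g T f π ≤
            2 * Cmax * T * volume.real Θ * kdeConst Θ α Cα
              * (Real.log n / n) ^ (α / (2 * α + d)) := by

  set h := optimalBandwidth d n α with hdef
  have hh : 0 < h := optimalBandwidth_pos hn α
  have hn0 : n ≠ 0 := by omega
  have hfm := (continuous_of_abs_sub_le_mul_rpow hα0 hfα).measurable
  have hfs := ae_eq_zero_of_densityMeasure_compl hΘm hfm hf0 hfΘ
  obtain ⟨hfi, hfint⟩ := integrable_of_densityMeasure hfm hf0 hf1
  have hΘt : volume Θ ≠ ⊤ := hΘb.measure_lt_top.ne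
  have hfΘ1 : ∫ x in Θ, f x = 1 := by
    rw [setIntegral_eq_integral_of_ae_compl_eq_zero hfs, hfint]
  have hV : 0 < volume.real Θ :=
    measureReal_pos_of_setIntegral_ne_zero hΘt (φ := f) (by simp [hfΘ1])
  have hfF := ae_le_of_holder hΘm hΘb hfi.integrableOn hfΘ1 hV hfs hα0 hCα hfα
  set ε : ℝ := volume.real Θ * √((Cα * l1Diameter Θ ^ α + 1 / volume.real Θ)
    / (h * √(4 * Real.pi)) ^ d / n) + √(2 * Real.log n / n) with hε
  have hXm' : Measurable fun ω i => X i ω := measurable_pi_iff.2 hXm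
  have hlaw : P.map (fun ω i => X i ω) = Measure.pi fun _ : Fin n => densityMeasure f := by
    rw [(iIndepFun_iff_map_fun_eq_pi_map fun i => (hXm i).aemeasurable).1 hXi]
    simp_rw [hXf]
  have hbad : MeasurableSet {Y : Fin n → EuclideanSpace ℝ (Fin d) | ε ≤ gaussDeviation h f Θ Y} :=
    measurableSet_le measurable_const (measurable_gaussDeviation hfm h Θ n)
  refine ⟨((fun ω i => X i ω) ⁻¹' {Y | ε ≤ gaussDeviation h f Θ Y})ᶜ, (hXm' hbad).compl, ?_, ?_⟩
  · have hconc := measure_gaussDeviation_ge_le (μ := densityMeasure f) (s := Θ)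
      hfm hf0 rfl hh hn0 hfF hΘt
    rw [finrank_euclideanSpace_fin, ← hε, ← hlaw, map_measureReal_apply hXm' hbad] at hconc
    rw [← ofReal_measureReal, probReal_compl_eq_one_sub (hXm' hbad)]
    exact ENNReal.ofReal_le_ofReal (by linarith)
  · intro ω hω π hπ
    have hdev : gaussDeviation h f Θ (fun i => X i ω) < ε := not_le.1 hω
    obtain ⟨x0, hx0⟩ := nonempty_of_measureReal_ne_zero hV.ne'
    -- The sign comes from an expected cost lying in `[0, T * Cmax]`; positive volume supplies the
    -- parameter.
    have hTC : 0 ≤ T * Cmax := by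
      have := (g ⟨x0, hx0⟩).expectedCost_mem_Icc π (hC _) T
      exact this.1.trans this.2
    have hfin : IsFiniteMeasure (volume.restrict Θ) := ⟨by simpa using hΘt.lt_top⟩
    have hpi : IntegrableOn (gaussEstimate h fun i => X i ω) Θ :=
      Integrable.of_mem_Icc _ _ (((measurable_gaussEstimate h n).comp
        (measurable_prodMk_left (x := fun i => X i ω))).aemeasurable)
        (.of_forall (gaussEstimate_mem_Icc hh hn0 _))
    rw [gaussianKDE_eq_gaussEstimate] at hπ
    have h1 := regret_le_of_isBayesOptimal hΘm hg hC hfi.integrableOn hpi hπ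
    have h2 := regret_le_mul_integral (T := T) hΘm hg hC hfi.integrableOn hf0 π
    rw [hfΘ1] at h2
    rw [← optimalBandwidth_rpow, ← hdef]
    have e : 2 * Cmax * T * volume.real Θ * kdeConst Θ α Cα * h ^ α
        = T * Cmax * (2 * volume.real Θ * kdeConst Θ α Cα * h ^ α) := by ring
    rw [e]
    rcases one_le_or_integral_abs_sub_le hd hn hΘm hΘb hf0 hf1 hfΘ hfb hα0 hα1 hCα hfα
      (fun i => X i ω) hdev with h3 | h3
    · exact h2.trans (mul_le_mul_of_nonneg_left h3 hTC)
    · exact h1.trans (mul_le_mul_of_nonneg_left h3 hTC)
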